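/- Let $L_2$ be the space of (a.e. classes of) square-integrable $u:[0,\infty)\to\mathbb R$ with norm $\|\cdot\|_2$, and $L_{2e}$ the space of those $u:[0,\infty)\to\mathbb R$ whose truncation to $[0,T]$ is in $L_2$ for every $T\ge 0$. Let $R:L_{2e}\to L_{2e}$ be linear and time-invariant (it commutes with every delay $\sigma_T$, $T\ge 0$, where $(\sigma_Tu)(t)=u(t-T)$ for $t\ge T$ and $0$ for $t<T$), with transfer function $R(s)$, a rational function with real coefficients: on some right half-plane the Laplace transforms satisfy $Y(s)=R(s)U(s)$ for $y=Ru$, wherever the Laplace integral of $u$ converges absolutely. Gains. Let $\operatorname{dom}(R)=\{u\in L_2 : Ru\in L_2\}$ and $$\Gamma(R)=\sup_{u_1\ne u_2\in \operatorname{dom}(R)}\frac{\|Ru_1-Ru_2\|_2}{\|u_1-u_2\|_2},\qquad \gamma(R)=\sup_{0\neq u\in\operatorname{dom}(R)}\frac{\|Ru\|_2}{\|u\|_2}\qquad(\text{in }[0,\infty]).$$ Extended SRG. Let $\operatorname{Nyquist}(R)=\{R(j\omega) : \omega\in\mathbb R,\ j\omega\text{ not a pole}\}$. A subset $S$ of the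 closed upper half-plane is h-convex if for all $z_1,z_2\in S$ it contains the arc between $z_1$ and $z_2$ of the upper half of the circle through $z_1,z_2$ centred on $\mathbb R$ (the segment $[z_1,z_2]$ if $\operatorname{Re}z_1=\operatorname{Re}z_2$). Let $H$ be the smallest h-convex set containing the points of $\operatorname{Nyquist}(R)$ with nonnegative imaginary part, and $\mathcal G_R=H\cup\overline H$ (with $\overline H$ the set of complex conjugates). Let $n_{\mathrm p}$ be the number of poles of $R(s)$ with positive real part, counted with multiplicity. For $z\in\mathbb C$ let $N_R(z)\in\mathbb Z$ be the number of clockwise encirclements of $z$ by the image under $R(s)$ of the D-contour, which runs along the imaginary axis from $-j\rho$ to $j\rho$, with semicircular indentations of radius $\varepsilon$ into the right half-plane around the poles on the axis, and then along $\rho e^{j\phi}$ with $\phi$ going from $\pi/2$ to $-\pi/2$, for all sufficiently small $\varepsilon>0$ and sufficiently large $\rho$. Let $\mathcal N_R$ be the set of those $z$ for which $N_R(z)$ is defined and $N_R(z)+n_{\mathrm p}>0$, and put $$\mathrm{SRG}'(R)=\mathcal G_R\cup\mathcal N_R .$$ For $C\subseteq\mathbb C$ let $\operatorname{radius}(C)=\inf\{r>0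 : |z|\le r\text{ for all }z\in C\}\in[0,\infty]$. Lemma. If $\mathrm{SRG}'(R)$ is bounded, then $R$ is stable: every pole $p$ of $R(s)$ satisfies $\operatorname{Re}p<0$, $R$ maps $L_2$ into $L_2$, and $\Gamma(R)<\infty$ and $\gamma(R)<\infty$. Moreover $$\operatorname{radius}(\mathrm{SRG}'(R))=\Gamma(R)=\gamma(R).$$ -/

import Mathlib

open MeasureTheory Filter Topology
open scoped ENNReal

noncomputable section

namespace ExtSRG

/-! ### Signals on `[0, ∞)`, the spaces `L₂` and `L₂ₑ` -/

/-- Lebesgue measure on the time axis `[0, ∞)`. -/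
def timeMeasure : Measure ℝ := volume.restrict (Set.Ici 0)

/-- Real-valued signals on `[0, ∞)`, up to almost everywhere equality. -/
abbrev Signal : Type := ℝ →ₘ[timeMeasure] ℝ

/-- The truncation `P_T u`, equal to `u` on `[0, T]` and to `0` afterwards. -/
def truncate (T : ℝ) (u : Signal) : Signal :=
  AEEqFun.mk (Set.indicator (Set.Iic T) u)
    (u.stronglyMeasurable.indicator measurableSet_Iic).aestronglyMeasurable

/-- The translation `σ_T u`, equal to `u (t - T)` for `t ≥ T` and to `0` before. -/
def shift (T : ℝ) (u : Signal) : Signal :=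
  AEEqFun.mk (Set.indicator (Set.Ici T) fun t => u (t - T))
    ((u.stronglyMeasurable.comp_measurable
      (measurable_id.sub_const T)).indicator measurableSet_Ici).aestronglyMeasurable

/-- The (extended-real-valued) `L₂` norm of a signal. -/
def l2norm (u : Signal) : ℝ≥0∞ := eLpNorm u 2 timeMeasure

theorem memLp_truncate_iff (T : ℝ) (u : Signal) :
    l2norm (truncate T u) < ∞ ↔
      MemLp u 2 (timeMeasure.restrict (Set.Iic T)) := by
  have h : l2norm (truncate T u) = eLpNorm u 2 (timeMeasure.restrict (Set.Iic T)) := by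
    unfold l2norm truncate
    rw [eLpNorm_congr_ae (AEEqFun.coeFn_mk _ _),
      eLpNorm_indicator_eq_eLpNorm_restrict measurableSet_Iic]
  rw [h]
  exact ⟨fun h => ⟨u.aestronglyMeasurable.restrict, h⟩, fun h => h.2⟩

/-- The extended space `L₂ₑ` of signals all of whose truncations have finite `L₂` norm. -/
def L2e : Submodule ℝ Signal where
  carrier := {u | ∀ T : ℝ, 0 ≤ T → l2norm (truncate T u) < ∞}
  add_mem' {u v} hu hv T hT := by
    have h1 := (memLp_truncate_iff T u).1 (hu T hT)
    have h2 := (memLp_truncate_iff T v).1 (hv T hT)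
    refine (memLp_truncate_iff T (u + v)).2 ((h1.add h2).ae_eq ?_)
    exact ae_restrict_of_ae (AEEqFun.coeFn_add u v).symm
  zero_mem' T _ := by
    refine (memLp_truncate_iff T 0).2 (MemLp.zero.ae_eq ?_)
    exact ae_restrict_of_ae AEEqFun.coeFn_zero.symm
  smul_mem' c u hu T hT := by
    refine (memLp_truncate_iff T (c • u)).2
      ((((memLp_truncate_iff T u).1 (hu T hT)).const_smul c).ae_eq ?_)
    exact ae_restrict_of_ae (AEEqFun.coeFn_smul c u).symm

theorem shift_mem_L2e {T : ℝ} (hT : 0 ≤ T) {u : Signal} (hu : u ∈ L2e) :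
    shift T u ∈ L2e := by
  intro S hS
  rw [memLp_truncate_iff]
  have hae : (shift T u : ℝ → ℝ) =ᵐ[timeMeasure]
      Set.indicator (Set.Ici T) fun t => u (t - T) := AEEqFun.coeFn_mk _ _
  refine MemLp.ae_eq (ae_restrict_of_ae hae.symm) ?_
  have h := (memLp_truncate_iff S u).1 (hu S hS)
  have hshift : MeasurePreserving (fun t : ℝ => t - T) volume volume :=
    measurePreserving_sub_right volume T
  have hμ : timeMeasure.restrict (Set.Iic S) = volume.restrict (Set.Iic S ∩ Set.Ici 0) :=
    Measure.restrict_restrict measurableSet_Iic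
  rw [hμ] at h ⊢
  rw [memLp_indicator_iff_restrict measurableSet_Ici,
    Measure.restrict_restrict measurableSet_Ici]
  have hpre : MeasurePreserving (fun t : ℝ => t - T)
      (volume.restrict ((fun t : ℝ => t - T) ⁻¹' (Set.Iic S ∩ Set.Ici 0)))
      (volume.restrict (Set.Iic S ∩ Set.Ici 0)) :=
    hshift.restrict_preimage (measurableSet_Iic.inter measurableSet_Ici)
  refine (h.comp_measurePreserving hpre).mono_measure (Measure.restrict_mono ?_ le_rfl)
  intro t ht
  simp only [Set.mem_inter_iff, Set.mem_Ici, Set.mem_Iic, Set.mem_preimage] at ht ⊢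
  constructor <;> linarith

/-- The translation `σ_T` on `L₂ₑ`. -/
def shiftL2e (T : ℝ) (hT : 0 ≤ T) (u : L2e) : L2e := ⟨shift T u, shift_mem_L2e hT u.2⟩

/-! ### Systems, stability and gains -/

/-- The domain of `R` as an operator on `L₂`: the `L₂` inputs with an `L₂` output. -/
def l2dom (R : L2e → L2e) : Set L2e := {u | l2norm u < ∞ ∧ l2norm (R u) < ∞}

/-- `R` maps `L₂` into `L₂`. -/
def IsL2Stable (R : L2e → L2e) : Prop := ∀ u : L2e, l2norm u < ∞ → l2norm (R u) < ∞

/-- The incremental gain `Γ(R)`. -/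
def incGain (R : L2e → L2e) : ℝ≥0∞ :=
  ⨆ (u₁ ∈ l2dom R) (u₂ ∈ l2dom R) (_ : u₁ ≠ u₂),
    l2norm (R u₁ - R u₂ : L2e) / l2norm (u₁ - u₂ : L2e)

/-- The non-incremental gain `γ(R)`. -/
def gain (R : L2e → L2e) : ℝ≥0∞ :=
  ⨆ (u ∈ l2dom R) (_ : u ≠ 0), l2norm (R u) / l2norm u

/-- Linear time-invariant systems. -/
structure IsLTI (R : L2e → L2e) : Prop where
  linear : ∀ (α : ℝ) (u₁ u₂ : L2e), R (α • u₁ + u₂) = α • R u₁ + R u₂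
  time_invariant : ∀ (T : ℝ) (hT : 0 ≤ T) (u : L2e), R (shiftL2e T hT u) = shiftL2e T hT (R u)

/-! ### Transfer functions -/

/-- The integrand of the Laplace transform of `u` at `s`. -/
def laplaceIntegrand (u : Signal) (s : ℂ) (t : ℝ) : ℂ := Complex.exp (-s * t) * (u t : ℂ)

/-- The Laplace transform of `u` at `s` (used only where the integral converges absolutely). -/
def laplace (u : Signal) (s : ℂ) : ℂ := ∫ t, laplaceIntegrand u s t ∂timeMeasure

/-- The value at `s ∈ ℂ` of a rational function with real coefficients. -/
def value (G : RatFunc ℝ) (s : ℂ) : ℂ := G.eval (algebraMap ℝ ℂ) s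

/-- `G` is the transfer function of `R`: on some right half-plane, the output `y = R u` satisfies
`Y(s) = G(s) U(s)` wherever the Laplace integral of the input `u` converges absolutely. -/
def HasTransferFunction (R : L2e → L2e) (G : RatFunc ℝ) : Prop :=
  ∃ σ : ℝ, ∀ (u : L2e) (s : ℂ), σ < s.re → Integrable (laplaceIntegrand u s) timeMeasure →
    Integrable (laplaceIntegrand (R u) s) timeMeasure ∧
      laplace (R u) s = value G s * laplace u s

/-- The complex poles of `G`, with multiplicity. -/
def poles (G : RatFunc ℝ) : Multiset ℂ := (G.denom.map (algebraMap ℝ ℂ)).roots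

/-- The number `n_p` of poles in the open right half-plane, counted with multiplicity. -/
def numUnstablePoles (G : RatFunc ℝ) : ℕ := ((poles G).filter fun p => 0 < p.re).card

/-- The poles on the imaginary axis. -/
def imagPoles (G : RatFunc ℝ) : Finset ℂ := (poles G).toFinset.filter fun p => p.re = 0

/-- The Nyquist diagram `{G(jω) | ω ∈ ℝ}`, over the `ω` for which `jω` is not a pole. -/
def nyquist (G : RatFunc ℝ) : Set ℂ :=
  {z | ∃ ω : ℝ, (ω * Complex.I : ℂ) ∉ poles G ∧ value G (ω * Complex.I) = z}

/-! ### Winding numbers along the Nyquist contour -/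

/-- The continuous curve `c : [a, b] → ℂ` avoids `z` and has (counterclockwise) winding number `n`
around `z`: some continuous logarithm of `c - z` increases by `2πi n`. -/
def HasWindingNumber (c : ℝ → ℂ) (a b : ℝ) (z : ℂ) (n : ℤ) : Prop :=
  ∃ θ : ℝ → ℂ, ContinuousOn θ (Set.Icc a b) ∧ (∀ t ∈ Set.Icc a b, c t - z = Complex.exp (θ t)) ∧
    θ b - θ a = 2 * Real.pi * Complex.I * n

/-- The real part of the imaginary axis with a semicircular indentation of radius `ε`, into the
right half-plane, around each imaginary pole (`Real.sqrt` vanishes on negative numbers). -/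
def indent (G : RatFunc ℝ) (ε ω : ℝ) : ℝ :=
  ∑ p ∈ imagPoles G, Real.sqrt (ε ^ 2 - (ω - p.im) ^ 2)

/-- The D-contour with radius `r`, parametrised by `[-r, r + π]`: the indented imaginary axis
from `-jr` to `jr`, then the arc `r e^{jφ}` with `φ` going from `π/2` to `-π/2`. -/
def dContour (G : RatFunc ℝ) (ε r t : ℝ) : ℂ :=
  if t ≤ r then (indent G ε t : ℂ) + t * Complex.I
  else r * Complex.exp (((Real.pi / 2 - (t - r) : ℝ) : ℂ) * Complex.I)

/-- `N_G(z) = n`: the image under `G` of the D-contour encircles `z` exactly `n` times clockwise,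
for all small indentations and all large radii. -/
def HasClockwiseEncirclements (G : RatFunc ℝ) (z : ℂ) (n : ℤ) : Prop :=
  ∀ᶠ ε in 𝓝[>] (0 : ℝ), ∀ᶠ r in atTop,
    HasWindingNumber (fun t => value G (dContour G ε r t)) (-r) (r + Real.pi) z (-n)

/-- The set `𝒩_G` of points `z` with `N_G(z) + n_p > 0`. (Points on the Nyquist diagram have no
encirclement number and are not in this set.) -/
def encircledSet (G : RatFunc ℝ) : Set ℂ :=
  {z | ∃ n : ℤ, HasClockwiseEncirclements G z n ∧ 0 < n + (numUnstablePoles G : ℤ)}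

/-! ### Hyperbolic convexity and the extended SRG -/

/-- `Arc_min(z₁, z₂)` for `z₁, z₂` in the closed upper half-plane: the part between `z₁` and `z₂` of
the upper half of the circle through them centred on the real axis; for equal real parts, where
that circle degenerates to a vertical line, the segment between them. -/
def arcMin (z₁ z₂ : ℂ) : Set ℂ :=
  {z | 0 ≤ z.im ∧
    ((z₁.re = z₂.re ∧ z ∈ segment ℝ z₁ z₂) ∨
      (z₁.re ≠ z₂.re ∧ min z₁.re z₂.re ≤ z.re ∧ z.re ≤ max z₁.re z₂.re ∧
        ∃ x : ℝ, ‖z₁ - x‖ = ‖z₂ - x‖ ∧ ‖z - x‖ = ‖z₁ - x‖))}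

/-- Hyperbolic convexity of a subset of the closed upper half-plane. -/
def IsHConvex (S : Set ℂ) : Prop :=
  ∀ z₁ z₂ : ℂ, 0 ≤ z₁.im → 0 ≤ z₂.im → ((z₁ ∈ S ∧ z₂ ∈ S) ↔ arcMin z₁ z₂ ⊆ S)

/-- The smallest h-convex subset of the closed upper half-plane that contains `P`. -/
def hHullUpper (P : Set ℂ) : Set ℂ :=
  ⋂₀ {S | S ⊆ {z : ℂ | 0 ≤ z.im} ∧ P ⊆ S ∧ IsHConvex S}

/-- The h-convex hull of a set that is symmetric with respect to the real axis. -/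
def hHull (P : Set ℂ) : Set ℂ :=
  hHullUpper (P ∩ {z | 0 ≤ z.im}) ∪
    (starRingEnd ℂ) '' hHullUpper (P ∩ {z | 0 ≤ z.im})

/-- The extended scaled relative graph `SRG'(G)`. -/
def extendedSRG (G : RatFunc ℝ) : Set ℂ := hHull (nyquist G) ∪ encircledSet G

/-- The radius of `C ⊆ ℂ`: the infimum of the `r > 0` with `C ⊆ D_r(0)` (and `∞` if none). -/
def radius (C : Set ℂ) : ℝ≥0∞ :=
  ⨅ (r : ℝ) (_ : 0 < r) (_ : C ⊆ Metric.closedBall 0 r), ENNReal.ofReal r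

end ExtSRG

end

noncomputable section

namespace ExtSRG

section

open FourierTransform SchwartzMap Complex

/-! ### Fourier transforms of integrable functions and Plancherel's identity -/

/-! Write G = N/D in lowest terms and let r bound the extended SRG, hence the Nyquist diagram. Then
|N| ≤ r|D| on the imaginary axis, which excludes poles there and forces deg N ≤ deg D. By the
argument principle, N_G(z) + n_p counts the zeros of N - zD in the open right half-plane, provided
that neither D nor N - zD vanishes on the axis. Near an unstable pole G would take a value z with
|z| > r at a point of that half-plane. This z would be encircled and so belong to the extended SRG,
which is absurd (`re_neg_of_mem_poles`).

For stable poles the radius and the gain both measure the supremum of |G(jω)|. On the geometric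
side, hyperbolic arcs stay in every disc about 0 that contains their endpoints, and the maximum
modulus principle keeps the image of the D-contour in such a disc, so nothing outside is encircled
(`extendedSRG_subset_closedBall`). On the analytic side, Y = GU extends to the whole right
half-plane (`transfer_on_right_half_plane`). Plancherel on the lines Re s = a, with a → 0, then
bounds the gain (`l2norm_le`), and testing with decaying exponentials bounds |G| by the gain
(`norm_value_le_of_gain_le`). Linearity identifies the two gains. -/

theorem ae_eq_of_forall_integral_schwartz_smul {f g : ℝ → ℂ} (hf : LocallyIntegrable f)
    (hg : LocallyIntegrable g) (h : ∀ φ : 𝓢(ℝ, ℂ), ∫ x, φ x • f x = ∫ x, φ x • g x) :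
    f =ᵐ[volume] g := by
  refine ae_eq_of_integral_contDiff_smul_eq hf hg fun φ hφ hc => ?_
  have hc' : HasCompactSupport (Complex.ofRealCLM ∘ φ) := hc.comp_left rfl
  have hφ' : ContDiff ℝ ((⊤ : ℕ∞) : WithTop ℕ∞) (Complex.ofRealCLM ∘ φ) := Complex.ofRealCLM.contDiff.comp hφ
  simpa using h (hc'.toSchwartzMap hφ')

theorem integral_schwartz_smul_fourier {f : ℝ → ℂ} (hf : Integrable f) (φ : 𝓢(ℝ, ℂ)) :
    ∫ x, φ x • 𝓕 f x = ∫ x, (𝓕 φ) x • f x := by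
  have h := VectorFourier.integral_fourierIntegral_smul_eq_flip (L := innerₗ ℝ) (μ := volume)
    (ν := volume) (e := Real.fourierChar) (f := φ) (g := f) Real.continuous_fourierChar
    continuous_inner φ.integrable hf
  rw [flip_innerₗ] at h
  exact h.symm

theorem integral_schwartz_smul_lpFourier (g : Lp (α := ℝ) ℂ 2) (φ : 𝓢(ℝ, ℂ)) :
    ∫ x, φ x • (𝓕 g : Lp (α := ℝ) ℂ 2) x = ∫ x, (𝓕 φ) x • g x := by
  have h := congrArg (fun T => T φ) (Lp.fourier_toTemperedDistribution_eq g)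
  simpa [TemperedDistribution.fourier_apply] using h.symm

theorem continuous_fourier {f : ℝ → ℂ} (hf : Integrable f) : Continuous (𝓕 f) :=
  VectorFourier.fourierIntegral_continuous Real.continuous_fourierChar
    (L := innerₗ ℝ) continuous_inner hf

/-- Plancherel's identity for the Fourier transform of an integrable function. -/
theorem eLpNorm_fourier_eq {f : ℝ → ℂ} (hf : Integrable f) (h2 : MemLp f 2) :
    eLpNorm (𝓕 f) 2 = eLpNorm f 2 := by
  set g : Lp ℂ 2 (volume : Measure ℝ) := h2.toLp f
  have hfg : g =ᵐ[volume] f := h2.coeFn_toLp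
  -- The L² transform and the integral transform have the same pairings with Schwartz functions, so
  -- Plancherel on L² carries over.
  have h : (𝓕 g : Lp ℂ 2 (volume : Measure ℝ)) =ᵐ[volume] 𝓕 f := by
    refine ae_eq_of_forall_integral_schwartz_smul ((Lp.memLp (μ := volume) _).locallyIntegrable one_le_two)
      (continuous_fourier hf).locallyIntegrable fun φ => ?_
    rw [integral_schwartz_smul_lpFourier, integral_schwartz_smul_fourier hf]
    refine integral_congr_ae ?_
    filter_upwards [hfg] with x hx
    rw [hx]
  rw [← eLpNorm_congr_ae h, ← eLpNorm_congr_ae hfg]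
  have h3 := Lp.norm_fourier_eq g
  rw [Lp.norm_def, Lp.norm_def] at h3
  exact (ENNReal.toReal_eq_toReal_iff' (Lp.eLpNorm_ne_top _) (Lp.eLpNorm_ne_top _)).1 h3

/-- An integrable function whose Fourier transform is square integrable is square integrable. -/
theorem memLp_two_of_fourier {f : ℝ → ℂ} (hf : Integrable f) (h2 : MemLp (𝓕 f) 2) :
    MemLp f 2 := by
  set g : Lp ℂ 2 (volume : Measure ℝ) := 𝓕⁻ (h2.toLp (𝓕 f))
  have hg : 𝓕 g = h2.toLp (𝓕 f) := fourier_fourierInv_eq _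
  have h : g =ᵐ[volume] f := by
    refine ae_eq_of_forall_integral_schwartz_smul ((Lp.memLp (μ := volume) _).locallyIntegrable one_le_two)
      hf.locallyIntegrable fun φ => ?_
    have h1 := integral_schwartz_smul_lpFourier g (𝓕⁻ φ)
    have h3 := integral_schwartz_smul_fourier hf (𝓕⁻ φ)
    rw [hg] at h1
    rw [fourier_fourierInv_eq] at h1 h3
    rw [← h1, ← h3]
    refine integral_congr_ae ?_
    filter_upwards [h2.coeFn_toLp] with x hx
    rw [hx]
  exact (memLp_congr_ae h).1 (Lp.memLp g)

/-- An integrable function with vanishing Fourier transform vanishes. -/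
theorem ae_eq_zero_of_fourier_eq_zero {f : ℝ → ℂ} (hf : Integrable f) (h : 𝓕 f = 0) :
    f =ᵐ[volume] 0 := by
  have h2 : MemLp (𝓕 f) 2 := h ▸ MemLp.zero
  have h3 := eLpNorm_fourier_eq hf (memLp_two_of_fourier hf h2)
  rw [h, eLpNorm_zero] at h3
  exact (eLpNorm_eq_zero_iff hf.1 (by norm_num)).1 h3.symm

/-! ### The bilateral Laplace transform on the right half-plane -/

/-- The bilateral Laplace transform. -/
def bilaplace (u : ℝ → ℂ) (s : ℂ) : ℂ := ∫ t : ℝ, exp (-s * t) * u t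

/-- The Laplace integral of `u` converges absolutely on the open right half-plane. -/
def LaplaceConvergent (u : ℝ → ℂ) : Prop :=
  ∀ s : ℂ, 0 < s.re → Integrable fun t : ℝ => exp (-s * t) * u t

theorem fourier_exp_mul (u : ℝ → ℂ) (a ξ : ℝ) :
    𝓕 (fun t : ℝ => exp (-(a : ℂ) * t) * u t) ξ = bilaplace u (a + 2 * Real.pi * ξ * I) := by
  rw [Real.fourier_eq', bilaplace]
  congr 1
  ext t
  rw [smul_eq_mul, ← mul_assoc, ← Complex.exp_add]
  congr 2
  simp
  ring

/-- On the single line Re s = a the Laplace transform is the Fourier transform of the signal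
weighted by e^{-at}, and that transform is injective. -/
theorem ae_eq_of_bilaplace_eq {u v : ℝ → ℂ} (a : ℝ)
    (hu : Integrable fun t : ℝ => exp (-(a : ℂ) * t) * u t)
    (hv : Integrable fun t : ℝ => exp (-(a : ℂ) * t) * v t)
    (h : ∀ s : ℂ, s.re = a → bilaplace u s = bilaplace v s) : u =ᵐ[volume] v := by
  have hF : 𝓕 (fun t : ℝ => exp (-(a : ℂ) * t) * u t - exp (-(a : ℂ) * t) * v t) = 0 := by
    ext ξ
    have := h (a + 2 * Real.pi * ξ * I) (by simp)
    rw [← fourier_exp_mul, ← fourier_exp_mul, Real.fourier_eq, Real.fourier_eq] at this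
    rw [Real.fourier_eq]
    simp only [smul_sub, Pi.zero_apply]
    rw [integral_sub, this, sub_self]
    · exact (Real.fourierIntegral_convergent_iff ξ).2 hu
    · exact (Real.fourierIntegral_convergent_iff ξ).2 hv
  filter_upwards [ae_eq_zero_of_fourier_eq_zero (hu.sub hv) hF] with t ht
  rw [Pi.zero_apply, Pi.sub_apply, ← mul_sub] at ht
  exact sub_eq_zero.1 ((mul_eq_zero.1 ht).resolve_left (exp_ne_zero _))

/-- Plancherel on the line Re s = a. Square integrability of the weighted output is not assumed: it
follows from that of its Fourier transform, which is dominated by M times the transform of the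
weighted input. -/
theorem eLpNorm_exp_mul_le {u y : ℝ → ℂ} (hu : LaplaceConvergent u) (hy : LaplaceConvergent y)
    {H : ℂ → ℂ} {M : ℝ} (hH : ∀ s : ℂ, 0 < s.re → ‖H s‖ ≤ M)
    (h : ∀ s : ℂ, 0 < s.re → bilaplace y s = H s * bilaplace u s) {a : ℝ} (ha : 0 < a)
    (hu2 : MemLp (fun t : ℝ => exp (-(a : ℂ) * t) * u t) 2) :
    eLpNorm (fun t : ℝ => exp (-(a : ℂ) * t) * y t) 2 ≤
      ENNReal.ofReal M * eLpNorm (fun t : ℝ => exp (-(a : ℂ) * t) * u t) 2 := by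
  have hu1 := hu a (by simpa using ha)
  have hy1 := hy a (by simpa using ha)
  have hle : ∀ ξ, ‖𝓕 (fun t : ℝ => exp (-(a : ℂ) * t) * y t) ξ‖ ≤
      M * ‖𝓕 (fun t : ℝ => exp (-(a : ℂ) * t) * u t) ξ‖ := fun ξ => by
    rw [fourier_exp_mul, fourier_exp_mul, h _ (by simpa using ha), norm_mul]
    gcongr
    exact hH _ (by simpa using ha)
  have hF := eLpNorm_le_mul_eLpNorm_of_ae_le_mul (μ := volume) (ae_of_all _ hle) 2
  have hFu : MemLp (𝓕 (fun t : ℝ => exp (-(a : ℂ) * t) * u t)) 2 :=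
    ⟨(continuous_fourier hu1).aestronglyMeasurable, eLpNorm_fourier_eq hu1 hu2 ▸ hu2.2⟩
  have hFy : MemLp (𝓕 (fun t : ℝ => exp (-(a : ℂ) * t) * y t)) 2 :=
    ⟨(continuous_fourier hy1).aestronglyMeasurable,
      hF.trans_lt (ENNReal.mul_lt_top ENNReal.ofReal_lt_top hFu.2)⟩
  rwa [eLpNorm_fourier_eq hu1 hu2, eLpNorm_fourier_eq hy1 (memLp_two_of_fourier hy1 hFy)] at hF

/-- The function `H` on the right half-plane is the transfer function of a map on signals whose
Laplace integral converges there. -/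
def Realizable (H : ℂ → ℂ) : Prop :=
  ∀ u, LaplaceConvergent u → ∃ y, LaplaceConvergent y ∧
    ∀ s : ℂ, 0 < s.re → bilaplace y s = H s * bilaplace u s

theorem Realizable.congr {H K : ℂ → ℂ} (hH : Realizable H) (h : ∀ s : ℂ, 0 < s.re → H s = K s) :
    Realizable K := fun u hu => by
  obtain ⟨y, hy, hyu⟩ := hH u hu
  exact ⟨y, hy, fun s hs => by rw [hyu s hs, h s hs]⟩

theorem Realizable.mul {H K : ℂ → ℂ} (hH : Realizable H) (hK : Realizable K) :
    Realizable fun s => H s * K s := fun u hu => by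
  obtain ⟨v, hv, hvu⟩ := hK u hu
  obtain ⟨y, hy, hyv⟩ := hH v hv
  exact ⟨y, hy, fun s hs => by rw [hyv s hs, hvu s hs, mul_assoc]⟩

theorem Realizable.add {H K : ℂ → ℂ} (hH : Realizable H) (hK : Realizable K) :
    Realizable fun s => H s + K s := fun u hu => by
  obtain ⟨v, hv, hvu⟩ := hK u hu
  obtain ⟨y, hy, hyu⟩ := hH u hu
  refine ⟨fun t => y t + v t, fun s hs => ?_, fun s hs => ?_⟩
  · simp only [mul_add]
    exact (hy s hs).add (hv s hs)
  · rw [add_mul, ← hyu s hs, ← hvu s hs]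
    simp only [bilaplace, mul_add]
    exact integral_add (hy s hs) (hv s hs)

theorem Realizable.const (c : ℂ) : Realizable fun _ => c := fun u hu => by
  refine ⟨fun t => c * u t, fun s hs => ?_, fun s hs => ?_⟩
  · simpa only [mul_left_comm] using (hu s hs).const_mul c
  · simp only [bilaplace, mul_left_comm _ c]
    exact integral_const_mul _ _

/-- The output is the convolution of u with e^{pt} on t > 0. The weight e^{-st} is multiplicative,
so it passes inside the convolution. -/
theorem Realizable.inv_sub {p : ℂ} (hp : p.re < 0) : Realizable fun s => (s - p)⁻¹ := by
  intro u hu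
  have hk : ∀ s : ℂ, 0 < s.re → Integrable (fun t : ℝ =>
      exp (-s * t) * (Set.Ioi (0 : ℝ)).indicator (fun t : ℝ => exp (p * t)) t) ∧
      ∫ t : ℝ, exp (-s * t) * (Set.Ioi (0 : ℝ)).indicator (fun t : ℝ => exp (p * t)) t
        = (s - p)⁻¹ := by
    intro s hs
    have h0 : (p - s).re < 0 := by simp; linarith
    have : (fun t : ℝ => exp (-s * t) * (Set.Ioi (0 : ℝ)).indicator (fun t : ℝ => exp (p * t)) t)
        = (Set.Ioi (0 : ℝ)).indicator (fun t : ℝ => exp ((p - s) * t)) := by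
      ext t
      by_cases ht : t ∈ Set.Ioi (0 : ℝ)
      · rw [Set.indicator_of_mem ht, Set.indicator_of_mem ht, ← Complex.exp_add]
        congr 1
        ring
      · rw [Set.indicator_of_notMem ht, Set.indicator_of_notMem ht, mul_zero]
    rw [this]
    refine ⟨(integrable_indicator_iff measurableSet_Ioi).2
      (integrableOn_exp_mul_complex_Ioi h0 0), ?_⟩
    rw [integral_indicator measurableSet_Ioi, integral_exp_mul_complex_Ioi h0]
    simp only [ofReal_zero, mul_zero, Complex.exp_zero]
    rw [← neg_sub s p, neg_div_neg_eq, one_div]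
  set k : ℝ → ℂ := (Set.Ioi (0 : ℝ)).indicator (fun t : ℝ => exp (p * t))
  have hconv : ∀ s : ℂ, (fun t : ℝ => exp (-s * t) * convolution k u (.mul ℂ ℂ) volume t) =
      convolution (fun t : ℝ => exp (-s * t) * k t) (fun t : ℝ => exp (-s * t) * u t)
        (.mul ℂ ℂ) volume := by
    intro s
    ext t
    rw [convolution_def, convolution_def, ← integral_const_mul]
    congr 1
    ext x
    simp only [ContinuousLinearMap.mul_apply']
    have : exp (-s * t) = exp (-s * x) * exp (-s * (t - x : ℝ)) := by
      rw [← Complex.exp_add]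
      congr 1
      push_cast
      ring
    rw [this]
    ring
  refine ⟨convolution k u (.mul ℂ ℂ) volume, fun s hs => ?_, fun s hs => ?_⟩
  · rw [hconv]
    exact (hk s hs).1.integrable_convolution _ (hu s hs)
  · rw [bilaplace, hconv, integral_convolution _ (hk s hs).1 (hu s hs), (hk s hs).2]
    rfl

-- Partial fractions one root at a time: N = N(p) + (X - p)Q splits N / ((X - p)M) into Q/M plus
-- N(p) · (1/M) · 1/(s - p), where Q has degree one less than N unless N is constant.
open Polynomial in
theorem realizable_div_prod (m : Multiset ℂ) (hm : ∀ p ∈ m, p.re < 0) (N : ℂ[X])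
    (hN : N.natDegree ≤ m.card) :
    Realizable fun s => N.eval s / ((m.map fun p => X - C p).prod).eval s := by
  induction m using Multiset.induction generalizing N with
  | empty =>
    obtain ⟨c, rfl⟩ := natDegree_eq_zero.1 (Nat.le_zero.1 hN)
    simpa using Realizable.const c
  | cons p m ih =>
    have hp : p.re < 0 := hm p (Multiset.mem_cons_self p m)
    have hm' : ∀ q ∈ m, q.re < 0 := fun q hq => hm q (Multiset.mem_cons_of_mem hq)
    have hQ : (N /ₘ (X - C p)).natDegree ≤ m.card := by
      rw [natDegree_divByMonic _ (monic_X_sub_C p), natDegree_X_sub_C]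
      simp at hN
      omega
    have h1 := ih hm' _ hQ
    have h2 := ((Realizable.const (N.eval p)).mul (ih hm' 1 (by simp))).mul (.inv_sub hp)
    refine (h1.add h2).congr fun s hs => ?_
    have hsp : ∀ q : ℂ, q.re < 0 → s - q ≠ 0 := fun q hq h => by
      rw [sub_eq_zero.1 h] at hs
      exact lt_asymm hs hq
    have hprod : ((m.map fun p => X - C p).prod).eval s ≠ 0 := by
      rw [eval_multiset_prod, Multiset.map_map]
      refine Multiset.prod_ne_zero fun h => ?_
      obtain ⟨q, hq, hq0⟩ := Multiset.mem_map.1 h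
      exact hsp q (hm' q hq) (by simpa using hq0)
    have hdiv := congrArg (eval s) (modByMonic_add_div N (X - C p))
    rw [modByMonic_X_sub_C_eq_C_eval] at hdiv
    simp only [eval_add, eval_mul, eval_sub, eval_X, eval_C] at hdiv
    rw [Multiset.map_cons, Multiset.prod_cons]
    simp only [eval_mul, eval_sub, eval_X, eval_C, eval_one]
    rw [← hdiv]
    have := hsp p hp
    field_simp
    ring

end

section

open Polynomial Complex

/-! ### Rational functions as quotients of complex polynomials -/

/-- The numerator of `G` as a complex polynomial. -/
def numC (G : RatFunc ℝ) : ℂ[X] := G.num.map (algebraMap ℝ ℂ)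

/-- The denominator of `G` as a complex polynomial. -/
def denC (G : RatFunc ℝ) : ℂ[X] := G.denom.map (algebraMap ℝ ℂ)

theorem value_eq (G : RatFunc ℝ) (s : ℂ) : value G s = (numC G).eval s / (denC G).eval s := by
  rw [value, RatFunc.eval, numC, denC, eval_map, eval_map]

theorem monic_denC (G : RatFunc ℝ) : (denC G).Monic := (RatFunc.monic_denom G).map _

theorem denC_ne_zero (G : RatFunc ℝ) : denC G ≠ 0 := (monic_denC G).ne_zero

theorem mem_poles {G : RatFunc ℝ} {s : ℂ} : s ∈ poles G ↔ (denC G).eval s = 0 :=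
  mem_roots (denC_ne_zero G)

/-- The Bézout identity over ℝ persists over ℂ, so no complex zero is common to both polynomials. -/
theorem numC_eval_ne_zero {G : RatFunc ℝ} {s : ℂ} (hs : s ∈ poles G) : (numC G).eval s ≠ 0 := by
  obtain ⟨a, b, hab⟩ := (RatFunc.isCoprime_num_denom G).map (mapRingHom (algebraMap ℝ ℂ))
  intro h0
  have h := congrArg (eval s) hab
  have h1 : eval s (mapRingHom (algebraMap ℝ ℂ) G.num) = 0 := h0
  have h2 : eval s (mapRingHom (algebraMap ℝ ℂ) G.denom) = 0 := mem_poles.1 hs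
  rw [eval_add, eval_mul, eval_mul, h1, h2] at h
  simp at h

theorem conj_eval_map (P : ℝ[X]) (s : ℂ) :
    (P.map (algebraMap ℝ ℂ)).eval (starRingEnd ℂ s) =
      starRingEnd ℂ ((P.map (algebraMap ℝ ℂ)).eval s) := by
  rw [eval_map, eval_map, hom_eval₂]
  congr 1
  ext x
  simp

theorem conj_mem_nyquist {G : RatFunc ℝ} {z : ℂ} (hz : z ∈ nyquist G) :
    starRingEnd ℂ z ∈ nyquist G := by
  obtain ⟨ω, hω, rfl⟩ := hz
  have h : (((-ω : ℝ) : ℂ) * I) = starRingEnd ℂ (ω * I) := by simp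
  refine ⟨-ω, ?_, ?_⟩
  · rw [h, mem_poles, denC, conj_eval_map, map_eq_zero]
    rwa [mem_poles] at hω
  · rw [h, value_eq, value_eq, numC, denC, conj_eval_map, conj_eval_map, map_div₀]

/-! ### The hyperbolic hull -/

theorem subset_hHullUpper (P : Set ℂ) : P ⊆ hHullUpper P := fun _ hz _ hS => hS.2.1 hz

theorem nyquist_subset_extendedSRG (G : RatFunc ℝ) : nyquist G ⊆ extendedSRG G := by
  intro z hz
  refine Or.inl ?_
  rcases le_total 0 z.im with h | h
  · exact Or.inl (subset_hHullUpper _ ⟨hz, h⟩)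
  · exact Or.inr ⟨starRingEnd ℂ z, subset_hHullUpper _ ⟨conj_mem_nyquist hz, by simpa using h⟩,
      Complex.conj_conj z⟩

theorem left_right_mem_arcMin {z₁ z₂ : ℂ} (h₁ : 0 ≤ z₁.im) (h₂ : 0 ≤ z₂.im) :
    z₁ ∈ arcMin z₁ z₂ ∧ z₂ ∈ arcMin z₁ z₂ := by
  by_cases h : z₁.re = z₂.re
  · exact ⟨⟨h₁, Or.inl ⟨h, left_mem_segment ℝ _ _⟩⟩, h₂, Or.inl ⟨h, right_mem_segment ℝ _ _⟩⟩
  · have hd : z₁.re - z₂.re ≠ 0 := sub_ne_zero.2 h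
    obtain ⟨x, hx⟩ : ∃ x : ℝ, ‖z₁ - x‖ = ‖z₂ - x‖ := by
      refine ⟨(normSq z₁ - normSq z₂) / (2 * (z₁.re - z₂.re)), ?_⟩
      rw [norm_def, norm_def]
      congr 1
      simp only [normSq_apply, sub_re, sub_im, ofReal_re, ofReal_im]
      field_simp
      ring
    exact ⟨⟨h₁, Or.inr ⟨h, min_le_left _ _, le_max_left _ _, x, hx, rfl⟩⟩,
      h₂, Or.inr ⟨h, min_le_right _ _, le_max_right _ _, x, hx, hx.symm⟩⟩

/-- Along a circle centred on the real axis, |z|² is an affine function of Re z. Hence on an arc it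
is largest at an endpoint. -/
theorem normSq_eq_of_norm_sub_eq {z w : ℂ} {x : ℝ} (h : ‖z - x‖ = ‖w - x‖) :
    normSq z = normSq w + 2 * x * (z.re - w.re) := by
  have h2 : normSq (z - x) = normSq (w - x) := by rw [normSq_eq_norm_sq, normSq_eq_norm_sq, h]
  simp only [normSq_apply, sub_re, sub_im, ofReal_re, ofReal_im] at h2 ⊢
  linarith

theorem norm_le_of_mem_arcMin {z₁ z₂ z : ℂ} {r : ℝ} (h₁ : ‖z₁‖ ≤ r) (h₂ : ‖z₂‖ ≤ r)
    (hz : z ∈ arcMin z₁ z₂) : ‖z‖ ≤ r := by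
  obtain ⟨-, ⟨-, hs⟩ | ⟨-, hmin, hmax, x, hx, hxz⟩⟩ := hz
  · have := (convex_closedBall (0 : ℂ) r).segment_subset (mem_closedBall_zero_iff.2 h₁)
      (mem_closedBall_zero_iff.2 h₂) hs
    exact mem_closedBall_zero_iff.1 this
  · have hr : 0 ≤ r := (norm_nonneg _).trans h₁
    rw [← sq_le_sq₀ (norm_nonneg _) hr, ← normSq_eq_norm_sq] at h₁ h₂ ⊢
    have e1 := normSq_eq_of_norm_sub_eq hxz
    have e2 := normSq_eq_of_norm_sub_eq (hxz.trans hx)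
    rcases le_total z₁.re z₂.re with h | h
    · rw [min_eq_left h] at hmin
      rw [max_eq_right h] at hmax
      rcases le_total 0 x with h0 | h0 <;> nlinarith
    · rw [min_eq_right h] at hmin
      rw [max_eq_left h] at hmax
      rcases le_total 0 x with h0 | h0 <;> nlinarith

theorem hHullUpper_subset_closedBall {P : Set ℂ} (hP : P ⊆ {z | 0 ≤ z.im}) {r : ℝ}
    (hr : P ⊆ Metric.closedBall 0 r) : hHullUpper P ⊆ Metric.closedBall 0 r := by
  -- The upper half-disc is itself h-convex, so it competes in the intersection that defines the
  -- hull.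
  refine (Set.sInter_subset_of_mem (t := {z : ℂ | 0 ≤ z.im} ∩ Metric.closedBall 0 r) ?_).trans
    Set.inter_subset_right
  refine ⟨Set.inter_subset_left, Set.subset_inter hP hr, fun z₁ z₂ h₁ h₂ => ⟨?_, fun h => ?_⟩⟩
  · rintro ⟨hz₁, hz₂⟩ z hz
    exact ⟨hz.1, mem_closedBall_zero_iff.2 (norm_le_of_mem_arcMin
      (mem_closedBall_zero_iff.1 hz₁.2) (mem_closedBall_zero_iff.1 hz₂.2) hz)⟩
  · have := left_right_mem_arcMin h₁ h₂
    exact ⟨h this.1, h this.2⟩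

theorem hHull_subset_closedBall {P : Set ℂ} {r : ℝ} (hr : P ⊆ Metric.closedBall 0 r) :
    hHull P ⊆ Metric.closedBall 0 r := by
  have h := hHullUpper_subset_closedBall (P := P ∩ {z | 0 ≤ z.im}) Set.inter_subset_right
    (Set.inter_subset_left.trans hr)
  rintro z (hz | ⟨w, hw, rfl⟩)
  · exact h hz
  · simpa using h hw

/-! ### Consequences of a bounded Nyquist diagram -/

theorem tendsto_eval_div_pow (P : ℂ[X]) {k : ℕ} (hk : P.natDegree ≤ k) :
    Tendsto (fun s : ℂ => P.eval s / s ^ k) (Bornology.cobounded ℂ) (𝓝 (P.coeff k)) := by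
  have h : ∀ i ∈ Finset.range (k + 1), Tendsto (fun s : ℂ => P.coeff i * s ^ i / s ^ k)
      (Bornology.cobounded ℂ) (𝓝 (if i = k then P.coeff k else 0)) := by
    intro i hi
    have hik : i ≤ k := Nat.lt_succ_iff.1 (Finset.mem_range.1 hi)
    have h0 : ∀ᶠ s : ℂ in Bornology.cobounded ℂ, s ≠ 0 := Bornology.eventually_ne_cobounded 0
    have h1 : Tendsto (fun s : ℂ => P.coeff i * (s⁻¹) ^ (k - i)) (Bornology.cobounded ℂ)
        (𝓝 (P.coeff i * 0 ^ (k - i))) := (tendsto_inv₀_cobounded.pow _).const_mul _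
    have h2 : P.coeff i * (0 : ℂ) ^ (k - i) = if i = k then P.coeff k else 0 := by
      split_ifs with hi'
      · subst hi'; simp
      · rw [zero_pow (by omega), mul_zero]
    rw [← h2]
    refine h1.congr' (h0.mono fun s hs => ?_)
    have h3 : s ^ k = s ^ i * s ^ (k - i) := by rw [← pow_add]; congr 1; omega
    beta_reduce
    rw [h3, inv_pow]
    field_simp
  have h4 := tendsto_finsetSum _ h
  rw [Finset.sum_ite_eq' (Finset.range (k + 1)) k fun _ => P.coeff k,
    if_pos (Finset.self_mem_range_succ k)] at h4
  refine h4.congr fun s => ?_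
  rw [eval_eq_sum_range' (Nat.lt_succ_of_le hk), Finset.sum_div]

theorem tendsto_ofReal_mul_I_cobounded :
    Tendsto (fun ω : ℝ => (ω * I : ℂ)) atTop (Bornology.cobounded ℂ) := by
  rw [← tendsto_norm_atTop_iff_cobounded]
  simpa using tendsto_abs_atTop_atTop

section BoundedNyquist

variable {G : RatFunc ℝ} {r : ℝ}

/-- With the denominator cleared, the bound is a closed condition on ω. It therefore extends from
the dense set of non-poles to all ω, and at a pole it would force the numerator to vanish. -/
theorem norm_numC_le (hr : ∀ z ∈ nyquist G, ‖z‖ ≤ r) (ω : ℝ) :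
    ‖(numC G).eval (ω * I)‖ ≤ r * ‖(denC G).eval (ω * I)‖ := by
  have hfin : {ω : ℝ | (ω * I : ℂ) ∈ poles G}.Finite :=
    (Multiset.finite_toSet (poles G)).preimage fun a _ b _ hab => by simpa using hab
  have hd : Dense {ω : ℝ | (ω * I : ℂ) ∈ poles G}ᶜ := hfin.countable.dense_compl ℝ
  have hc : IsClosed {ω : ℝ | ‖(numC G).eval (ω * I)‖ ≤ r * ‖(denC G).eval (ω * I)‖} :=
    isClosed_le (by fun_prop) (by fun_prop)
  have hsub : {ω : ℝ | (ω * I : ℂ) ∈ poles G}ᶜ ⊆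
      {ω : ℝ | ‖(numC G).eval (ω * I)‖ ≤ r * ‖(denC G).eval (ω * I)‖} := by
    intro ω hω
    have h1 := hr _ ⟨ω, hω, rfl⟩
    have h2 : (denC G).eval (ω * I) ≠ 0 := fun h => hω (mem_poles.2 h)
    rwa [value_eq, norm_div, div_le_iff₀ (norm_pos_iff.2 h2)] at h1
  exact hc.closure_subset_iff.2 hsub (hd ω)

theorem re_ne_zero_of_mem_poles (hr : ∀ z ∈ nyquist G, ‖z‖ ≤ r) {p : ℂ} (hp : p ∈ poles G) :
    p.re ≠ 0 := by
  intro h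
  have hpI : (p.im * I : ℂ) = p := by apply Complex.ext <;> simp [h]
  have h1 := norm_numC_le hr p.im
  rw [hpI, mem_poles.1 hp, norm_zero, mul_zero, norm_le_zero_iff] at h1
  exact numC_eval_ne_zero hp h1

theorem natDegree_numC_le (hr : ∀ z ∈ nyquist G, ‖z‖ ≤ r) :
    (numC G).natDegree ≤ (denC G).natDegree := by
  by_contra! hlt
  have h1 := ((tendsto_eval_div_pow (numC G) le_rfl).comp tendsto_ofReal_mul_I_cobounded).norm
  have h2 := (((tendsto_eval_div_pow (denC G) hlt.le).comp
    tendsto_ofReal_mul_I_cobounded).norm).const_mul r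
  rw [coeff_eq_zero_of_natDegree_lt hlt, norm_zero, mul_zero] at h2
  have h3 := le_of_tendsto_of_tendsto' h1 h2 fun ω => by
    simp only [Function.comp, norm_div]
    rw [← mul_div_assoc]
    gcongr
    exact norm_numC_le hr ω
  have h4 : numC G = 0 := leadingCoeff_eq_zero.1 (norm_le_zero_iff.1 h3)
  rw [h4, natDegree_zero] at hlt
  exact Nat.not_lt_zero _ hlt

theorem tendsto_value_cobounded (hdeg : (numC G).natDegree ≤ (denC G).natDegree) :
    Tendsto (value G) (Bornology.cobounded ℂ) (𝓝 ((numC G).coeff (denC G).natDegree)) := by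
  have h := (tendsto_eval_div_pow (numC G) hdeg).div
    (tendsto_eval_div_pow (denC G) le_rfl) (by simp [(monic_denC G).coeff_natDegree])
  rw [(monic_denC G).coeff_natDegree, div_one] at h
  refine h.congr' ?_
  filter_upwards [Bornology.eventually_ne_cobounded (0 : ℂ)] with s hs
  rw [value_eq, Pi.div_apply, div_div_div_cancel_right₀ (pow_ne_zero _ hs)]

theorem differentiableAt_value {s : ℂ} (hs : s ∉ poles G) : DifferentiableAt ℂ (value G) s := by
  have h : value G = fun s => (numC G).eval s / (denC G).eval s := funext (value_eq G)
  rw [h]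
  exact (numC G).differentiableAt.div (denC G).differentiableAt fun h => hs (mem_poles.2 h)

/-- The maximum modulus principle for proper transfer functions with stable poles. -/
theorem norm_value_le (hp : ∀ p ∈ poles G, p.re < 0) (hr : ∀ z ∈ nyquist G, ‖z‖ ≤ r) {s : ℂ}
    (hs : 0 ≤ s.re) : ‖value G s‖ ≤ r := by
  have hnot : ∀ {s : ℂ}, 0 ≤ s.re → s ∉ poles G := fun hs h => (hp _ h).not_ge hs
  have hO := (tendsto_value_cobounded (natDegree_numC_le hr)).isBigO_one ℝ
  refine PhragmenLindelof.right_half_plane_of_bounded_on_real (f := value G) ?_ ?_ ?_ ?_ hs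
  · refine DifferentiableOn.diffContOnCl fun s hs => ?_
    rw [Complex.closure_setOfPred_lt_re] at hs
    exact (differentiableAt_value (hnot hs)).differentiableWithinAt
  -- Properness gives G a finite limit at infinity, so the growth condition holds with the
  -- exponential factor equal to 1.
  · refine ⟨1, by norm_num, 0, ?_⟩
    simpa using hO.mono inf_le_left
  · have hreal : Tendsto (fun x : ℝ => (x : ℂ)) atTop (Bornology.cobounded ℂ) := by
      rw [← tendsto_norm_atTop_iff_cobounded]
      simpa using tendsto_abs_atTop_atTop
    exact ((tendsto_value_cobounded (natDegree_numC_le hr)).comp hreal).norm.isBoundedUnder_le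
  · exact fun x => hr _ ⟨x, hnot (by simp), rfl⟩

end BoundedNyquist

end

section

open Polynomial Complex

/-! ### Winding numbers -/

theorem HasWindingNumber.congr {c c' : ℝ → ℂ} {a b : ℝ} {z : ℂ} {n : ℤ}
    (h : HasWindingNumber c a b z n) (hcc : ∀ t ∈ Set.Icc a b, c t = c' t) :
    HasWindingNumber c' a b z n := by
  obtain ⟨θ, h1, h2, h3⟩ := h
  exact ⟨θ, h1, fun t ht => by rw [← hcc t ht, h2 t ht], h3⟩

theorem hasWindingNumber_iff_sub {c : ℝ → ℂ} {a b : ℝ} {z : ℂ} {n : ℤ} :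
    HasWindingNumber c a b z n ↔ HasWindingNumber (fun t => c t - z) a b 0 n := by
  simp only [HasWindingNumber, sub_zero]

theorem hasWindingNumber_const {w : ℂ} (hw : w ≠ 0) (a b : ℝ) :
    HasWindingNumber (fun _ => w) a b 0 0 :=
  ⟨fun _ => log w, continuousOn_const, fun t _ => by rw [sub_zero, exp_log hw], by simp⟩

theorem HasWindingNumber.mul {c d : ℝ → ℂ} {a b : ℝ} {m n : ℤ} (hc : HasWindingNumber c a b 0 m)
    (hd : HasWindingNumber d a b 0 n) : HasWindingNumber (fun t => c t * d t) a b 0 (m + n) := by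
  obtain ⟨θ, h1, h2, h3⟩ := hc
  obtain ⟨η, k1, k2, k3⟩ := hd
  refine ⟨fun t => θ t + η t, h1.add k1, fun t ht => ?_, ?_⟩
  · rw [Complex.exp_add, ← h2 t ht, ← k2 t ht]
    ring
  · push_cast
    linear_combination h3 + k3

theorem HasWindingNumber.inv {c : ℝ → ℂ} {a b : ℝ} {n : ℤ} (hc : HasWindingNumber c a b 0 n) :
    HasWindingNumber (fun t => (c t)⁻¹) a b 0 (-n) := by
  obtain ⟨θ, h1, h2, h3⟩ := hc
  refine ⟨fun t => -θ t, h1.neg, fun t ht => ?_, ?_⟩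
  · rw [Complex.exp_neg, ← h2 t ht, sub_zero, sub_zero]
  · push_cast
    linear_combination -h3

theorem HasWindingNumber.multisetProd {c : ℝ → ℂ} {a b : ℝ} {m : Multiset ℂ} {w : ℂ → ℤ}
    (h : ∀ p ∈ m, HasWindingNumber c a b p (w p)) :
    HasWindingNumber (fun t => ((m.map fun p => X - C p).prod).eval (c t)) a b 0
      (m.map w).sum := by
  induction m using Multiset.induction with
  | empty => simpa using hasWindingNumber_const one_ne_zero a b
  | cons p m ih =>
    have h1 := hasWindingNumber_iff_sub.1 (h p (Multiset.mem_cons_self p m))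
    have h2 := ih fun q hq => h q (Multiset.mem_cons_of_mem hq)
    simpa using h1.mul h2

theorem HasWindingNumber.eval {c : ℝ → ℂ} {a b : ℝ} {P : ℂ[X]} (hP : P ≠ 0) {w : ℂ → ℤ}
    (h : ∀ p ∈ P.roots, HasWindingNumber c a b p (w p)) :
    HasWindingNumber (fun t => P.eval (c t)) a b 0 (P.roots.map w).sum := by
  have h1 := (hasWindingNumber_const (leadingCoeff_ne_zero.2 hP) a b).mul
    (HasWindingNumber.multisetProd h)
  rw [zero_add] at h1
  refine h1.congr fun t _ => ?_
  conv_rhs => rw [(IsAlgClosed.splits P).eq_prod_roots]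
  rw [eval_mul, eval_C]

/-- Two continuous logarithms differ by 2πi times a continuous integer-valued function, which is
constant on an interval. -/
theorem HasWindingNumber.unique {c : ℝ → ℂ} {a b : ℝ} (hab : a ≤ b) {z : ℂ} {m n : ℤ}
    (hm : HasWindingNumber c a b z m) (hn : HasWindingNumber c a b z n) : m = n := by
  obtain ⟨θ, h1, h2, h3⟩ := hm
  obtain ⟨η, k1, k2, k3⟩ := hn
  have h2pi : (2 * Real.pi * I : ℂ) ≠ 0 := Complex.two_pi_I_ne_zero
  have hint : ∀ t ∈ Set.Icc a b, ∃ k : ℤ, (θ t - η t) / (2 * Real.pi * I) = k := by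
    intro t ht
    obtain ⟨k, hk⟩ := Complex.exp_eq_exp_iff_exists_int.1 ((h2 t ht).symm.trans (k2 t ht))
    exact ⟨k, by rw [hk]; field_simp; ring⟩
  have hcont : ContinuousOn (fun t => ((θ t - η t) / (2 * Real.pi * I)).re) (Set.Icc a b) :=
    continuous_re.comp_continuousOn ((h1.sub k1).div_const _)
  have hdisc : IsDiscrete (Set.range ((↑) : ℤ → ℝ)) :=
    Int.isClosedEmbedding_coe_real.isInducing.isDiscrete_range
  have hconst := isPreconnected_Icc.constant_of_mapsTo hdisc hcont (fun t ht => by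
      obtain ⟨k, hk⟩ := hint t ht
      exact ⟨k, by simp only [hk, intCast_re]⟩) (Set.left_mem_Icc.2 hab) (Set.right_mem_Icc.2 hab)
  obtain ⟨k, hk⟩ := hint a (Set.left_mem_Icc.2 hab)
  obtain ⟨l, hl⟩ := hint b (Set.right_mem_Icc.2 hab)
  simp only [hk, hl, intCast_re, Int.cast_inj] at hconst
  subst hconst
  rw [div_eq_iff h2pi] at hk hl
  have : (2 * Real.pi * I : ℂ) * m = 2 * Real.pi * I * n := by
    linear_combination hl - hk - h3 + k3
  exact_mod_cast mul_left_cancel₀ h2pi this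

/-- Factor c - z = -z(1 - c/z): the second factor stays in the disc of radius 1 about 1, where the
principal logarithm is continuous. -/
theorem hasWindingNumber_zero_of_norm_lt {c : ℝ → ℂ} {a b : ℝ} (hab : a ≤ b) {z : ℂ}
    (hc : ContinuousOn c (Set.Icc a b)) (hz : ∀ t ∈ Set.Icc a b, ‖c t‖ < ‖z‖)
    (hcl : c a = c b) : HasWindingNumber c a b z 0 := by
  have hz0 : z ≠ 0 := norm_pos_iff.1 ((norm_nonneg _).trans_lt (hz a (Set.left_mem_Icc.2 hab)))
  have hlt : ∀ t ∈ Set.Icc a b, ‖-(c t / z)‖ < 1 := fun t ht => by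
    rw [norm_neg, norm_div, div_lt_one (norm_pos_iff.2 hz0)]
    exact hz t ht
  refine ⟨fun t => log (-z) + log (1 + -(c t / z)), ?_, fun t ht => ?_, ?_⟩
  · refine continuousOn_const.add (ContinuousOn.clog ?_ fun t ht =>
      mem_slitPlane_of_norm_lt_one (hlt t ht))
    exact continuousOn_const.add (hc.div_const z).neg
  · rw [Complex.exp_add, exp_log (neg_ne_zero.2 hz0),
      exp_log (slitPlane_ne_zero (mem_slitPlane_of_norm_lt_one (hlt t ht)))]
    field_simp
    ring
  · simp only [hcl]
    simp

/-! ### The D-contour without indentations -/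

section Contour

variable {G : RatFunc ℝ}

/-- The circular arc of the D-contour. -/
def contourArc (r t : ℝ) : ℂ := exp (((Real.pi / 2 - (t - r) : ℝ) : ℂ) * I)

theorem dContour_eq (h : imagPoles G = ∅) (ε r t : ℝ) :
    dContour G ε r t = if t ≤ r then t * I else r * contourArc r t := by
  simp [dContour, indent, h, contourArc]

theorem continuous_contourArc (r : ℝ) : Continuous (contourArc r) := by
  unfold contourArc
  fun_prop

theorem norm_contourArc (r t : ℝ) : ‖contourArc r t‖ = 1 := norm_exp_ofReal_mul_I _

theorem contourArc_self (r : ℝ) : contourArc r r = I := by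
  rw [contourArc, sub_self, sub_zero]
  push_cast
  exact exp_pi_div_two_mul_I

theorem contourArc_end (r : ℝ) : contourArc r (r + Real.pi) = -I := by
  rw [contourArc, show Real.pi / 2 - (r + Real.pi - r) = -(Real.pi / 2) by ring]
  push_cast
  rw [neg_mul, Complex.exp_neg, exp_pi_div_two_mul_I, inv_I]

theorem contourArc_re (r t : ℝ) : (contourArc r t).re = Real.sin (t - r) := by
  rw [contourArc, exp_ofReal_mul_I_re, Real.cos_pi_div_two_sub]

theorem continuous_dContour (h : imagPoles G = ∅) (ε r : ℝ) : Continuous (dContour G ε r) := by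
  rw [funext (dContour_eq h ε r)]
  refine Continuous.if_le (by fun_prop) (continuous_const.mul (continuous_contourArc r))
    continuous_id continuous_const fun t ht => ?_
  rw [show t = r from ht, contourArc_self]

theorem dContour_re_nonneg (h : imagPoles G = ∅) (ε : ℝ) {r t : ℝ} (hr : 0 ≤ r)
    (ht : t ≤ r + Real.pi) : 0 ≤ (dContour G ε r t).re := by
  rw [dContour_eq h]
  split_ifs with htr
  · simp
  · rw [re_ofReal_mul, contourArc_re]
    exact mul_nonneg hr (Real.sin_nonneg_of_nonneg_of_le_pi (by linarith) (by linarith))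

theorem dContour_start (h : imagPoles G = ∅) (ε : ℝ) {r : ℝ} (hr : 0 ≤ r) :
    dContour G ε r (-r) = -(r * I) := by
  rw [dContour_eq h, if_pos (by linarith)]
  simp

theorem dContour_end (h : imagPoles G = ∅) (ε r : ℝ) :
    dContour G ε r (r + Real.pi) = -(r * I) := by
  rw [dContour_eq h, if_neg (by linarith [Real.pi_pos]), contourArc_end]
  ring

theorem hasWindingNumber_dContour_of_re_neg (h : imagPoles G = ∅) (ε : ℝ) {r : ℝ} (hr : 0 ≤ r)
    {p : ℂ} (hp : p.re < 0) : HasWindingNumber (dContour G ε r) (-r) (r + Real.pi) p 0 := by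
  have hre : ∀ t ∈ Set.Icc (-r) (r + Real.pi), dContour G ε r t - p ∈ slitPlane := fun t ht => by
    refine Or.inl ?_
    have := dContour_re_nonneg h ε hr ht.2
    rw [sub_re]
    linarith
  refine ⟨fun t => log (dContour G ε r t - p), ?_, fun t ht => ?_, ?_⟩
  · exact ContinuousOn.clog ((continuous_dContour h ε r).continuousOn.sub continuousOn_const) hre
  · rw [exp_log (slitPlane_ne_zero (hre t ht))]
  · simp [dContour_start h ε hr, dContour_end h]

/-- The arguments x and arg v add up to less than π in absolute value, so the principal branch is
additive here. This glues the two logarithms below at the corners ±jr. -/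
theorem log_mul_exp_mul {r x : ℝ} (hr : 0 < r) (hx : |x| ≤ Real.pi / 2) {v : ℂ} (hv : 0 < v.re) :
    log (r * exp (x * I) * v) = Real.log r + x * I + log v := by
  have hv0 : v ≠ 0 := fun h => by simp [h] at hv
  have harg := abs_lt.1 (abs_arg_lt_pi_div_two_iff.2 (Or.inl hv))
  have hx' := abs_le.1 hx
  have him : (Real.log r + x * I + log v : ℂ).im = x + arg v := by simp [log_im]
  rw [← log_exp (x := Real.log r + x * I + log v) (by rw [him]; linarith)
    (by rw [him]; linarith), Complex.exp_add, Complex.exp_add, exp_log hv0, ← ofReal_exp,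
    Real.exp_log hr]

theorem hasWindingNumber_dContour_of_re_pos (h : imagPoles G = ∅) (ε : ℝ) {r : ℝ} {p : ℂ}
    (hp : 0 < p.re) (hpr : ‖p‖ < r) :
    HasWindingNumber (dContour G ε r) (-r) (r + Real.pi) p (-1) := by
  have hr : 0 < r := (norm_nonneg p).trans_lt hpr
  have hr0 : (r : ℂ) ≠ 0 := ofReal_ne_zero.2 hr.ne'
  have hlt : ∀ w : ℂ, ‖w‖ = 1 → ‖-(p / (r * w))‖ < 1 := fun w hw => by
    rwa [norm_neg, norm_div, norm_mul, hw, mul_one, norm_real, Real.norm_of_nonneg hr.le,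
      div_lt_one hr]
  have hre : ∀ w : ℂ, ‖w‖ = 1 → 0 < (1 + -(p / (r * w))).re := fun w hw => by
    have := (abs_lt.1 ((abs_re_le_norm _).trans_lt (hlt w hw))).1
    rw [add_re, one_re]
    linarith
  have hI : log (p - r * I) = Real.log r - Real.pi / 2 * I + log (1 + -(p / (r * I))) := by
    have h1 := log_mul_exp_mul (r := r) (x := -(Real.pi / 2)) hr
      (by rw [abs_neg, abs_of_pos Real.pi_div_two_pos]) (hre I norm_I)
    have h2 : exp (((-(Real.pi / 2) : ℝ) : ℂ) * I) = -I := by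
      push_cast
      rw [neg_mul, Complex.exp_neg, exp_pi_div_two_mul_I, inv_I]
    rw [h2, show (r : ℂ) * -I * (1 + -(p / (r * I))) = p - r * I by
      field_simp; ring] at h1
    rw [h1]
    push_cast
    ring
  have hI' : log (p + r * I) = Real.log r + Real.pi / 2 * I + log (1 + -(p / (r * -I))) := by
    have h1 := log_mul_exp_mul (r := r) (x := Real.pi / 2) hr
      (by rw [abs_of_pos Real.pi_div_two_pos]) (hre (-I) (by simp))
    have h2 : exp (((Real.pi / 2 : ℝ) : ℂ) * I) = I := by
      push_cast
      exact exp_pi_div_two_mul_I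
    rw [h2, show (r : ℂ) * I * (1 + -(p / (r * -I))) = p + r * I by
      field_simp; ring] at h1
    rw [h1]
    push_cast
    ring
  -- On the axis p - c has positive real part, and adding πi to its logarithm accounts for the sign
  -- of c - p. On the arc, c - p = c(1 - p/c) with |p/c| < 1. The branches agree at jr. At -jr the
  -- final value is 2πi below the initial one.
  refine ⟨fun t => if t ≤ r then log (p - t * I) + Real.pi * I else
    Real.log r + ((Real.pi / 2 - (t - r) : ℝ) : ℂ) * I + log (1 + -(p / (r * contourArc r t))),
    ?_, fun t ht => ?_, ?_⟩
  · refine (Continuous.if_le ?_ ?_ continuous_id continuous_const fun t ht => ?_).continuousOn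
    · refine Continuous.add (Continuous.clog (by fun_prop) fun t => ?_) continuous_const
      exact Or.inl (by simpa using hp)
    · refine Continuous.add (by fun_prop) (Continuous.clog ?_ fun t =>
        mem_slitPlane_of_norm_lt_one (hlt _ (norm_contourArc r t)))
      refine continuous_const.add (continuous_const.div
        (continuous_const.mul (continuous_contourArc r)) fun t => ?_).neg
      exact mul_ne_zero hr0 (Complex.exp_ne_zero _)
    · rw [show t = r from ht, contourArc_self, hI]
      push_cast
      ring
  · rw [dContour_eq h]
    beta_reduce
    split_ifs with htr
    · have h0 : p - t * I ≠ 0 := fun h0 => by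
        have := congrArg re h0
        simp at this
        exact hp.ne' this
      rw [Complex.exp_add, exp_log h0, exp_pi_mul_I]
      ring
    · have h0 := slitPlane_ne_zero (mem_slitPlane_of_norm_lt_one (hlt _ (norm_contourArc r t)))
      have h1 : contourArc r t ≠ 0 := Complex.exp_ne_zero _
      rw [Complex.exp_add, Complex.exp_add, exp_log h0, ← ofReal_exp, Real.exp_log hr,
        ← contourArc]
      field_simp
      ring
  · have hpi := Real.pi_pos
    simp only [if_neg (show ¬ r + Real.pi ≤ r by linarith), if_pos (show -r ≤ r by linarith),
      contourArc_end]
    rw [show p - ((-r : ℝ) : ℂ) * I = p + r * I by push_cast; ring, hI']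
    push_cast
    ring

theorem hasWindingNumber_eval_dContour (h : imagPoles G = ∅) (ε : ℝ) {r : ℝ} {P : ℂ[X]}
    (hP : P ≠ 0) (h0 : ∀ p ∈ P.roots, p.re ≠ 0) (hr : 0 ≤ r) (hpr : ∀ p ∈ P.roots, ‖p‖ < r) :
    HasWindingNumber (fun t => P.eval (dContour G ε r t)) (-r) (r + Real.pi) 0
      (-((P.roots.filter fun p => 0 < p.re).card : ℤ)) := by
  have h1 := HasWindingNumber.eval (c := dContour G ε r) (a := -r) (b := r + Real.pi) hP
    (w := fun p => if 0 < p.re then -1 else 0) fun p hp => by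
      split_ifs with hp0
      · exact hasWindingNumber_dContour_of_re_pos h ε hp0 (hpr p hp)
      · exact hasWindingNumber_dContour_of_re_neg h ε hr
          (lt_of_le_of_ne (not_lt.1 hp0) (h0 p hp))
  have h2 : ∀ m : Multiset ℂ, (m.map fun p => if 0 < p.re then (-1 : ℤ) else 0).sum =
      -((m.filter fun p => 0 < p.re).card : ℤ) := by
    intro m
    induction m using Multiset.induction with
    | empty => simp
    | cons p m ih =>
      by_cases hp0 : 0 < p.re <;> simp [hp0, ih, add_comm]
  rwa [h2] at h1

/-- The argument principle for rational functions without poles on the imaginary axis. -/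
theorem hasClockwiseEncirclements_of_roots (h : ∀ p ∈ poles G, p.re ≠ 0) {z : ℂ}
    (hz0 : numC G - C z * denC G ≠ 0) (hz : ∀ p ∈ (numC G - C z * denC G).roots, p.re ≠ 0) :
    HasClockwiseEncirclements G z
      ((((numC G - C z * denC G).roots.filter fun p => 0 < p.re).card : ℤ) -
        numUnstablePoles G) := by
  have himag : imagPoles G = ∅ := by
    refine Finset.filter_eq_empty_iff.2 fun p hp => h p (Multiset.mem_toFinset.1 hp)
  have hbound : ∀ m : Multiset ℂ, ∀ᶠ r : ℝ in atTop, ∀ p ∈ m, ‖p‖ < r := fun m => by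
    have := (Filter.eventually_all_finset (l := atTop) m.toFinset
      (p := fun p (r : ℝ) => ‖p‖ < r)).2 fun p _ => eventually_gt_atTop _
    simpa using this
  refine Eventually.of_forall fun ε => ?_
  filter_upwards [eventually_ge_atTop 0, hbound (numC G - C z * denC G).roots,
    hbound (denC G).roots] with r hr hr1 hr2
  -- G - z = (N - zD)/D along the contour, so the winding number is that of the numerator minus that
  -- of D.
  rw [hasWindingNumber_iff_sub]
  have h1 := (hasWindingNumber_eval_dContour himag ε hz0 hz hr hr1).mul
    (hasWindingNumber_eval_dContour himag ε (denC_ne_zero G) h hr hr2).inv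
  rw [neg_sub]
  rw [neg_neg, neg_add_eq_sub] at h1
  refine h1.congr fun t ht => ?_
  have hd : (denC G).eval (dContour G ε r t) ≠ 0 := fun hd => by
    have hp : dContour G ε r t ∈ (denC G).roots := mem_poles.2 hd
    have h3 := hr2 _ hp
    have h4 := h _ hp
    rw [dContour_eq himag] at h3 h4
    split_ifs at h3 h4 with htr
    · simp at h4
    · rw [norm_mul, norm_contourArc, mul_one, norm_real, Real.norm_of_nonneg hr] at h3
      exact lt_irrefl _ h3
  rw [value_eq]
  simp only [eval_sub, eval_mul, eval_C]
  field_simp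

theorem re_neg_of_mem_poles {r : ℝ} (hbd : extendedSRG G ⊆ Metric.closedBall 0 r) {p : ℂ}
    (hp : p ∈ poles G) : p.re < 0 := by
  have hr : ∀ z ∈ nyquist G, ‖z‖ ≤ r := fun z hz =>
    mem_closedBall_zero_iff.1 (hbd (nyquist_subset_extendedSRG G hz))
  have him := fun q (hq : q ∈ poles G) => re_ne_zero_of_mem_poles hr hq
  by_contra hneg
  have hpos : 0 < p.re := lt_of_le_of_ne (not_lt.1 hneg) (him p hp).symm
  have hN := numC_eval_ne_zero hp
  -- This is |G| > r with the denominator cleared, so that the pole p itself qualifies. Openness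
  -- then supplies a nearby s that is not a pole.
  have hopen : IsOpen {s : ℂ | 0 < s.re ∧ r * ‖(denC G).eval s‖ < ‖(numC G).eval s‖} :=
    (isOpen_lt continuous_const continuous_re).inter
      (isOpen_lt ((denC G).continuous.norm.const_mul r) (numC G).continuous.norm)
  have hd : Dense {s : ℂ | s ∈ poles G}ᶜ :=
    (Multiset.finite_toSet (poles G)).countable.dense_compl ℝ
  obtain ⟨s, ⟨hs0, hs⟩, hsp⟩ := hd.inter_open_nonempty _ hopen
    ⟨p, hpos, by rw [mem_poles.1 hp]; simpa using hN⟩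
  have hsD : (denC G).eval s ≠ 0 := fun h => hsp (mem_poles.2 h)
  set z : ℂ := (numC G).eval s / (denC G).eval s
  have hzr : r < ‖z‖ := by
    rw [norm_div]
    exact (lt_div_iff₀ (norm_pos_iff.2 hsD)).2 hs
  have hP : numC G - C z * denC G ≠ 0 := fun h => hN (by
    have := congrArg (eval p) h
    simpa [mem_poles.1 hp] using this)
  -- A root on the axis would put z on the Nyquist diagram, contradicting |z| > r.
  have hroots : ∀ q ∈ (numC G - C z * denC G).roots, q.re ≠ 0 := by
    intro q hq hq0
    have hq1 : (numC G).eval q - z * (denC G).eval q = 0 := by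
      simpa using (mem_roots hP).1 hq
    by_cases hqp : q ∈ poles G
    · exact him q hqp hq0
    · have hqI : (q.im * I : ℂ) = q := by apply Complex.ext <;> simp [hq0]
      refine hzr.not_ge (hr z ⟨q.im, by rwa [hqI], ?_⟩)
      rw [hqI, value_eq, div_eq_iff fun h => hqp (mem_poles.2 h)]
      exact sub_eq_zero.1 hq1
  have hs_root : s ∈ (numC G - C z * denC G).roots.filter fun p => 0 < p.re := by
    refine Multiset.mem_filter.2 ⟨(mem_roots hP).2 ?_, hs0⟩
    simp [z, div_mul_cancel₀ _ hsD]
  have hz : z ∈ encircledSet G := by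
    refine ⟨_, hasClockwiseEncirclements_of_roots him hP hroots, ?_⟩
    rw [sub_add_cancel]
    exact_mod_cast Multiset.card_pos_iff_exists_mem.2 ⟨s, hs_root⟩
  exact hzr.not_ge (mem_closedBall_zero_iff.1 (hbd (Or.inr hz)))

theorem extendedSRG_subset_closedBall (hp : ∀ p ∈ poles G, p.re < 0) {r : ℝ}
    (hr : ∀ z ∈ nyquist G, ‖z‖ ≤ r) : extendedSRG G ⊆ Metric.closedBall 0 r := by
  refine Set.union_subset (hHull_subset_closedBall fun z hz =>
    mem_closedBall_zero_iff.2 (hr z hz)) ?_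
  rintro z ⟨n, hn, hpos⟩
  rw [mem_closedBall_zero_iff]
  by_contra! hz
  have himag : imagPoles G = ∅ :=
    Finset.filter_eq_empty_iff.2 fun p h => (hp p (Multiset.mem_toFinset.1 h)).ne
  have hnp : numUnstablePoles G = 0 := by
    rw [numUnstablePoles, Multiset.card_eq_zero, Multiset.filter_eq_nil]
    exact fun p h => (hp p h).not_gt
  obtain ⟨ε, hε⟩ := hn.exists
  obtain ⟨ρ, hρ, hρ0⟩ := (hε.and (eventually_ge_atTop 0)).exists
  have hab : -ρ ≤ ρ + Real.pi := by linarith [Real.pi_pos]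
  have h0 := hasWindingNumber_zero_of_norm_lt
    (c := fun t => value G (dContour G ε ρ t)) (z := z) hab ?_ ?_ ?_
  · have := hρ.unique hab h0
    rw [hnp] at hpos
    omega
  · intro t ht
    have hnot : dContour G ε ρ t ∉ poles G := fun h =>
      (hp _ h).not_ge (dContour_re_nonneg himag ε hρ0 ht.2)
    exact ((differentiableAt_value hnot).continuousAt.comp
      (continuous_dContour himag ε ρ).continuousAt).continuousWithinAt
  · exact fun t ht => (norm_value_le hp hr (dContour_re_nonneg himag ε hρ0 ht.2)).trans_lt hz
  · simp only [dContour_start himag ε hρ0, dContour_end himag]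

end Contour

end

section

open Polynomial Complex

/-! ### Signals as functions on the whole line -/

/-- The extension by zero of a signal to the whole line. -/
def zeroExtend (u : Signal) : ℝ → ℂ := (Set.Ici 0).indicator fun t => (u t : ℂ)

theorem exp_mul_zeroExtend (u : Signal) (s : ℂ) :
    (fun t : ℝ => exp (-s * t) * zeroExtend u t) = (Set.Ici 0).indicator (laplaceIntegrand u s) := by
  ext t
  by_cases ht : t ∈ Set.Ici (0 : ℝ)
  · rw [zeroExtend, Set.indicator_of_mem ht, Set.indicator_of_mem ht, laplaceIntegrand]
  · rw [zeroExtend, Set.indicator_of_notMem ht, Set.indicator_of_notMem ht, mul_zero]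

theorem integrable_exp_mul_zeroExtend {u : Signal} {s : ℂ} :
    Integrable (fun t : ℝ => exp (-s * t) * zeroExtend u t) ↔
      Integrable (laplaceIntegrand u s) timeMeasure := by
  rw [exp_mul_zeroExtend, integrable_indicator_iff measurableSet_Ici, timeMeasure, IntegrableOn]

theorem bilaplace_zeroExtend (u : Signal) (s : ℂ) : bilaplace (zeroExtend u) s = laplace u s := by
  rw [bilaplace, exp_mul_zeroExtend, integral_indicator measurableSet_Ici, laplace, timeMeasure]

theorem eLpNorm_zeroExtend (u : Signal) : eLpNorm (zeroExtend u) 2 = l2norm u := by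
  rw [zeroExtend, eLpNorm_indicator_eq_eLpNorm_restrict measurableSet_Ici]
  exact eLpNorm_congr_norm_ae (ae_of_all _ fun t => norm_real _)

theorem aestronglyMeasurable_zeroExtend (u : Signal) : AEStronglyMeasurable (zeroExtend u) :=
  (continuous_ofReal.comp_stronglyMeasurable u.stronglyMeasurable).aestronglyMeasurable.indicator
    measurableSet_Ici

theorem integrable_exp_neg_mul {a : ℝ} (ha : 0 < a) :
    Integrable (fun t : ℝ => Real.exp (-a * t)) timeMeasure :=
  (integrableOn_Ici_iff_integrableOn_Ioi (by simp)).2 (integrableOn_exp_mul_Ioi (neg_lt_zero.2 ha) 0)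

theorem norm_exp_neg_mul_ofReal (s : ℂ) (t : ℝ) : ‖exp (-s * t)‖ = Real.exp (-s.re * t) := by
  rw [norm_exp]
  simp

theorem exp_neg_mul_sq (a t : ℝ) : Real.exp (-a * t) ^ 2 = Real.exp (-(2 * a) * t) := by
  rw [← Real.exp_nat_mul]
  congr 1
  push_cast
  ring

theorem memLp_exp_neg_mul {s : ℂ} (hs : 0 < s.re) :
    MemLp (fun t : ℝ => exp (-s * t)) 2 timeMeasure := by
  rw [memLp_two_iff_integrable_sq_norm (by fun_prop)]
  simp only [norm_exp_neg_mul_ofReal, exp_neg_mul_sq]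
  exact integrable_exp_neg_mul (by linarith)

theorem integrable_laplaceIntegrand {u : Signal} (hu : l2norm u < ∞) {s : ℂ} (hs : 0 < s.re) :
    Integrable (laplaceIntegrand u s) timeMeasure := by
  have h : MemLp (fun t => (u t : ℂ)) 2 timeMeasure :=
    MemLp.ofReal ⟨u.aestronglyMeasurable, hu⟩
  exact (memLp_exp_neg_mul hs).integrable_mul h

theorem laplaceConvergent_zeroExtend {u : Signal} (hu : l2norm u < ∞) :
    LaplaceConvergent (zeroExtend u) := fun _ hs =>
  integrable_exp_mul_zeroExtend.2 (integrable_laplaceIntegrand hu hs)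

theorem norm_exp_mul_zeroExtend_le (u : Signal) {a : ℝ} (ha : 0 ≤ a) (t : ℝ) :
    ‖exp (-(a : ℂ) * t) * zeroExtend u t‖ ≤ ‖zeroExtend u t‖ := by
  by_cases ht : t ∈ Set.Ici (0 : ℝ)
  · rw [norm_mul, norm_exp_neg_mul_ofReal]
    refine mul_le_of_le_one_left (norm_nonneg _) (Real.exp_le_one_iff.2 ?_)
    rw [ofReal_re, neg_mul]
    exact neg_nonpos.2 (mul_nonneg ha ht)
  · rw [zeroExtend, Set.indicator_of_notMem ht, mul_zero]

/-- Fatou's lemma along a = 1/(n+1) → 0. -/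
theorem eLpNorm_le_of_forall_exp_mul {y : ℝ → ℂ} (hy : AEStronglyMeasurable y) {C : ℝ≥0∞}
    (h : ∀ a : ℝ, 0 < a → eLpNorm (fun t : ℝ => exp (-(a : ℂ) * t) * y t) 2 ≤ C) :
    eLpNorm y 2 ≤ C := by
  refine (Lp.eLpNorm_lim_le_liminf_eLpNorm
    (f := fun (n : ℕ) (t : ℝ) => exp (-((1 / ((n : ℝ) + 1) : ℝ) : ℂ) * t) * y t)
    (fun n => ?_) y (ae_of_all _ fun t => ?_)).trans ?_
  · exact AEStronglyMeasurable.mul (by fun_prop) hy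
  · have h1 : Tendsto (fun a : ℝ => exp (-(a : ℂ) * t) * y t) (𝓝 0) (𝓝 (y t)) :=
      Continuous.tendsto' (by fun_prop) _ _ (by simp)
    exact h1.comp tendsto_one_div_add_atTop_nhds_zero_nat
  · refine (liminf_le_liminf (Eventually.of_forall fun n => h _ ?_)).trans
      (liminf_const C).le
    positivity

theorem mem_L2e_of_l2norm_lt_top {u : Signal} (hu : l2norm u < ∞) : u ∈ L2e := fun T _ =>
  (memLp_truncate_iff T u).2 (MemLp.restrict _ ⟨u.aestronglyMeasurable, hu⟩)

theorem l2norm_sq (u : Signal) (hu : l2norm u < ∞) :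
    l2norm u ^ 2 = ENNReal.ofReal (∫ t, u t ^ 2 ∂timeMeasure) := by
  have h := (show MemLp u 2 timeMeasure from ⟨u.aestronglyMeasurable, hu⟩).integrable_sq
  rw [ofReal_integral_eq_lintegral_ofReal h (ae_of_all _ fun t => sq_nonneg _), l2norm,
    eLpNorm_eq_lintegral_rpow_enorm_toReal (by norm_num) (by norm_num)]
  simp only [ENNReal.toReal_ofNat, ENNReal.rpow_ofNat]
  rw [← ENNReal.rpow_natCast, ← ENNReal.rpow_mul]
  norm_num
  refine lintegral_congr fun t => ?_
  rw [← ofReal_norm, ← ENNReal.ofReal_pow (norm_nonneg _), Real.norm_eq_abs, sq_abs]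

/-! ### The transfer function determines the gain -/

section Gain

variable {R : L2e → L2e} {G : RatFunc ℝ}

theorem realizable_value (hp : ∀ p ∈ poles G, p.re < 0)
    (hdeg : (numC G).natDegree ≤ (denC G).natDegree) : Realizable (value G) := by
  have hsplit := IsAlgClosed.splits (denC G)
  refine (realizable_div_prod (denC G).roots hp (numC G) ?_).congr fun s _ => ?_
  · rwa [← hsplit.natDegree_eq_card_roots]
  · rw [value_eq]
    conv_rhs => rw [hsplit.eq_prod_roots, (monic_denC G).leadingCoeff, C_1, one_mul]

/-- The hypothesis speaks only of Re s > σ. Stable poles and properness provide a convolution output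
y with the identity on all of Re s > 0, and uniqueness on the line Re s = max σ 0 + 1 identifies y
with Ru. -/
theorem transfer_on_right_half_plane (hG : HasTransferFunction R G)
    (hp : ∀ p ∈ poles G, p.re < 0) (hdeg : (numC G).natDegree ≤ (denC G).natDegree) {u : L2e}
    (hu : l2norm u < ∞) : LaplaceConvergent (zeroExtend (R u)) ∧ ∀ s : ℂ, 0 < s.re →
      bilaplace (zeroExtend (R u)) s = value G s * bilaplace (zeroExtend u) s := by
  obtain ⟨y, hy, hyu⟩ := realizable_value hp hdeg _ (laplaceConvergent_zeroExtend hu)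
  obtain ⟨σ, hσ⟩ := hG
  have ha : 0 < max σ 0 + 1 := by positivity
  have hsa : σ < max σ 0 + 1 := (le_max_left σ 0).trans_lt (lt_add_one _)
  have hae : zeroExtend (R u) =ᵐ[volume] y := by
    refine ae_eq_of_bilaplace_eq (max σ 0 + 1) ?_ (hy _ (by simpa using ha)) fun s hs => ?_
    · refine integrable_exp_mul_zeroExtend.2 (hσ u _ (by simpa using hsa) ?_).1
      exact integrable_laplaceIntegrand hu (by simpa using ha)
    · have hs0 : 0 < s.re := hs ▸ ha
      rw [hyu s hs0, bilaplace_zeroExtend, bilaplace_zeroExtend]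
      exact (hσ u s (hs ▸ hsa) (integrable_laplaceIntegrand hu hs0)).2
  have hae' : ∀ s : ℂ, (fun t : ℝ => exp (-s * t) * zeroExtend (R u) t) =ᵐ[volume]
      fun t => exp (-s * t) * y t := fun s => by
    filter_upwards [hae] with t ht
    rw [ht]
  refine ⟨fun s hs => (integrable_congr (hae' s)).2 (hy s hs), fun s hs => ?_⟩
  rw [← hyu s hs]
  exact integral_congr_ae (hae' s)

theorem l2norm_le (hG : HasTransferFunction R G) (hp : ∀ p ∈ poles G, p.re < 0) {r : ℝ}
    (hr : ∀ z ∈ nyquist G, ‖z‖ ≤ r) {u : L2e} (hu : l2norm u < ∞) :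
    l2norm (R u) ≤ ENNReal.ofReal r * l2norm u := by
  obtain ⟨hy, hyu⟩ := transfer_on_right_half_plane hG hp (natDegree_numC_le hr) hu
  rw [← eLpNorm_zeroExtend]
  refine eLpNorm_le_of_forall_exp_mul (aestronglyMeasurable_zeroExtend _) fun a ha => ?_
  have hle : eLpNorm (fun t : ℝ => exp (-(a : ℂ) * t) * zeroExtend u t) 2 ≤ l2norm u := by
    rw [← eLpNorm_zeroExtend]
    exact eLpNorm_mono (norm_exp_mul_zeroExtend_le _ ha.le)
  refine (eLpNorm_exp_mul_le (laplaceConvergent_zeroExtend hu) hy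
    (fun s hs => norm_value_le hp hr hs.le) hyu ha ⟨?_, hle.trans_lt hu⟩).trans (by gcongr)
  exact AEStronglyMeasurable.mul (by fun_prop) (aestronglyMeasurable_zeroExtend _)

theorem integral_sq_le {K : ℝ} (hK0 : 0 ≤ K)
    (hK : ∀ u : L2e, l2norm u < ∞ → l2norm (R u) ≤ ENNReal.ofReal K * l2norm u) {u : L2e}
    (hu : l2norm u < ∞) :
    ∫ t, (R u : Signal) t ^ 2 ∂timeMeasure ≤ K ^ 2 * ∫ t, (u : Signal) t ^ 2 ∂timeMeasure := by
  have hRu : l2norm (R u) < ∞ := (hK u hu).trans_lt (ENNReal.mul_lt_top ENNReal.ofReal_lt_top hu)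
  have h := pow_le_pow_left' (hK u hu) 2
  rw [mul_pow, l2norm_sq _ hRu, l2norm_sq _ hu, ← ENNReal.ofReal_pow hK0,
    ← ENNReal.ofReal_mul (by positivity)] at h
  refine (ENNReal.ofReal_le_ofReal_iff ?_).1 h
  exact mul_nonneg (sq_nonneg K) (integral_nonneg fun t => sq_nonneg _)

theorem integral_exp_neg_mul {a : ℝ} (ha : 0 < a) :
    ∫ t, Real.exp (-a * t) ∂timeMeasure = a⁻¹ := by
  rw [timeMeasure, integral_Ici_eq_integral_Ioi, integral_exp_mul_Ioi (neg_lt_zero.2 ha)]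
  simp [neg_div_neg_eq]

/-- A continuous function dominated by a decaying exponential is a signal in `L₂`. -/
theorem exists_L2e_of_abs_le {f : ℝ → ℝ} (hf : Continuous f) {a : ℝ} (ha : 0 < a)
    (hfa : ∀ t, |f t| ≤ Real.exp (-a * t)) :
    ∃ u : L2e, l2norm u < ∞ ∧ (u : Signal) =ᵐ[timeMeasure] f := by
  have h2 : MemLp f 2 timeMeasure := by
    rw [memLp_two_iff_integrable_sq hf.aestronglyMeasurable]
    refine (integrable_exp_neg_mul (a := 2 * a) (by linarith)).mono'
      (by fun_prop) (ae_of_all _ fun t => ?_)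
    rw [Real.norm_of_nonneg (sq_nonneg _), ← exp_neg_mul_sq, ← sq_abs]
    exact pow_le_pow_left₀ (abs_nonneg _) (hfa t) 2
  have hae := AEEqFun.coeFn_mk f (hf.aestronglyMeasurable (μ := timeMeasure))
  have hlt : l2norm (AEEqFun.mk f (hf.aestronglyMeasurable (μ := timeMeasure))) < ∞ := by
    rw [l2norm, eLpNorm_congr_ae hae]
    exact h2.2
  exact ⟨⟨_, mem_L2e_of_l2norm_lt_top hlt⟩, hlt, hae⟩

/-- An upper bound for the gain bounds the transfer function on the right half-plane. -/
theorem norm_value_le_of_gain_le (hG : HasTransferFunction R G) (hp : ∀ p ∈ poles G, p.re < 0)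
    (hdeg : (numC G).natDegree ≤ (denC G).natDegree) {K : ℝ} (hK0 : 0 < K)
    (hK : ∀ u : L2e, l2norm u < ∞ → l2norm (R u) ≤ ENNReal.ofReal K * l2norm u) {s : ℂ}
    (hs : 0 < s.re) : ‖value G s‖ ≤ K := by
  set a := s.re
  set b := s.im
  -- Signals are real, so the test input u₁ + i u₂ = exp(-s̄t) is split into its two parts. Its
  -- Laplace transform at s and its squared norm are both 1/(2a), the equality case of
  -- Cauchy–Schwarz.
  obtain ⟨u₁, hu₁, hae₁⟩ := exists_L2e_of_abs_le (f := fun t => Real.exp (-a * t) * Real.cos (b * t))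
    (by fun_prop) hs fun t => by
      rw [abs_mul, Real.abs_exp]
      exact mul_le_of_le_one_right (Real.exp_pos _).le (Real.abs_cos_le_one _)
  obtain ⟨u₂, hu₂, hae₂⟩ := exists_L2e_of_abs_le (f := fun t => Real.exp (-a * t) * Real.sin (b * t))
    (by fun_prop) hs fun t => by
      rw [abs_mul, Real.abs_exp]
      exact mul_le_of_le_one_right (Real.exp_pos _).le (Real.abs_sin_le_one _)
  have hy : ∀ {u : L2e}, l2norm u < ∞ → l2norm (R u) < ∞ := fun hu =>
    (hK _ hu).trans_lt (ENNReal.mul_lt_top ENNReal.ofReal_lt_top hu)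
  have hsq : ∀ {u : L2e}, l2norm u < ∞ →
      Integrable (fun t => (u : Signal) t ^ 2) timeMeasure := fun {u} hu =>
    (show MemLp (u : Signal) 2 timeMeasure from ⟨(u : Signal).aestronglyMeasurable, hu⟩).integrable_sq
  have h2a : 0 < 2 * a := by linarith
  have hin : laplace u₁ s + I * laplace u₂ s = ((2 * a)⁻¹ : ℝ) := by
    rw [laplace, laplace, ← integral_const_mul, ← integral_add (integrable_laplaceIntegrand hu₁ hs)
      ((integrable_laplaceIntegrand hu₂ hs).const_mul I), ← integral_exp_neg_mul h2a,
      ← integral_complex_ofReal]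
    refine integral_congr_ae ?_
    filter_upwards [hae₁, hae₂] with t h₁ h₂
    have hsab : s = a + b * I := (re_add_im s).symm
    have he : exp (-s * t) = exp (-a * t) * exp (-(b * t) * I) := by
      rw [← Complex.exp_add, hsab]
      congr 1
      ring
    have hb : (Real.cos (b * t) : ℂ) + Real.sin (b * t) * I = exp ((b * t) * I) := by
      rw [Complex.exp_mul_I]
      push_cast
      rfl
    have h1 : exp (-(b * t) * I) * exp ((b * t) * I) = 1 := by
      rw [← Complex.exp_add, neg_mul, neg_add_cancel, Complex.exp_zero]
    have h2 : (Real.exp (-(2 * a) * t) : ℂ) = exp (-a * t) * exp (-a * t) := by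
      rw [← exp_neg_mul_sq, sq]
      push_cast
      rfl
    simp only [laplaceIntegrand, h₁, h₂]
    rw [h2, he]
    push_cast at hb ⊢
    linear_combination exp (-a * t) * exp (-a * t) * (exp (-(b * t) * I) * hb + h1)
  have hout : laplace (R u₁) s + I * laplace (R u₂) s = value G s * ((2 * a)⁻¹ : ℝ) := by
    have h₁ := (transfer_on_right_half_plane hG hp hdeg hu₁).2 s hs
    have h₂ := (transfer_on_right_half_plane hG hp hdeg hu₂).2 s hs
    simp only [bilaplace_zeroExtend] at h₁ h₂
    rw [h₁, h₂, ← hin]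
    ring
  have hquot : Integrable (fun t => ((R u₁ : Signal) t ^ 2 + (R u₂ : Signal) t ^ 2) / K)
      timeMeasure := ((hsq (hy hu₁)).add (hsq (hy hu₂))).div_const K
  -- Cauchy–Schwarz in the weighted form pq ≤ (Kp² + q²/K)/2. The weight K balances the two terms:
  -- each integrates to at most K/(2a).
  have hnorm : ‖laplace (R u₁) s + I * laplace (R u₂) s‖ ≤
      ∫ t, (K * Real.exp (-(2 * a) * t) +
        ((R u₁ : Signal) t ^ 2 + (R u₂ : Signal) t ^ 2) / K) / 2 ∂timeMeasure := by
    rw [laplace, laplace, ← integral_const_mul,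
      ← integral_add (integrable_laplaceIntegrand (hy hu₁) hs)
      ((integrable_laplaceIntegrand (hy hu₂) hs).const_mul I)]
    refine norm_integral_le_of_norm_le ?_ (ae_of_all _ fun t => ?_)
    · exact (((integrable_exp_neg_mul h2a).const_mul K).add hquot).div_const 2
    · set x := (R u₁ : Signal) t
      set y := (R u₂ : Signal) t
      have hxy : ‖(x + I * y : ℂ)‖ ^ 2 = x ^ 2 + y ^ 2 := by
        rw [← normSq_eq_norm_sq, mul_comm I, normSq_add_mul_I]
      have he : laplaceIntegrand (R u₁) s t + I * laplaceIntegrand (R u₂) s t =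
          exp (-s * t) * (x + I * y) := by
        simp only [laplaceIntegrand, x, y]
        ring
      rw [he, norm_mul, norm_exp_neg_mul_ofReal, ← hxy, ← exp_neg_mul_sq]
      set p := Real.exp (-s.re * t)
      set q := ‖(x + I * y : ℂ)‖
      have : (K * p ^ 2 + q ^ 2 / K) / 2 - p * q = (K * p - q) ^ 2 / (2 * K) := by
        field_simp
        ring
      have h0 : 0 ≤ (K * p - q) ^ 2 / (2 * K) := by positivity
      linarith
  have hu12 : ∫ t, (u₁ : Signal) t ^ 2 ∂timeMeasure + ∫ t, (u₂ : Signal) t ^ 2 ∂timeMeasure =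
      (2 * a)⁻¹ := by
    rw [← integral_add (hsq hu₁) (hsq hu₂), ← integral_exp_neg_mul h2a]
    refine integral_congr_ae ?_
    filter_upwards [hae₁, hae₂] with t h₁ h₂
    simp only [h₁, h₂]
    rw [← exp_neg_mul_sq]
    linear_combination Real.exp (-a * t) ^ 2 * Real.sin_sq_add_cos_sq (b * t)
  have hy₁ := integral_sq_le hK0.le hK hu₁
  have hy₂ := integral_sq_le hK0.le hK hu₂
  rw [hout, integral_div, integral_add ((integrable_exp_neg_mul h2a).const_mul K) hquot, integral_const_mul, integral_div,
    integral_add (hsq (hy hu₁)) (hsq (hy hu₂)), integral_exp_neg_mul h2a, norm_mul, norm_real,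
    Real.norm_of_nonneg (by positivity)] at hnorm
  have hsum : (∫ t, (R u₁ : Signal) t ^ 2 ∂timeMeasure + ∫ t, (R u₂ : Signal) t ^ 2 ∂timeMeasure) / K
      ≤ K * (2 * a)⁻¹ := by
    rw [div_le_iff₀ hK0, ← hu12]
    nlinarith
  refine le_of_mul_le_mul_right (hnorm.trans ?_) (inv_pos.2 h2a)
  linarith

theorem norm_nyquist_le_of_gain_le (hG : HasTransferFunction R G) (hp : ∀ p ∈ poles G, p.re < 0)
    (hdeg : (numC G).natDegree ≤ (denC G).natDegree) {K : ℝ} (hK0 : 0 < K)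
    (hK : ∀ u : L2e, l2norm u < ∞ → l2norm (R u) ≤ ENNReal.ofReal K * l2norm u) :
    ∀ z ∈ nyquist G, ‖z‖ ≤ K := by
  rintro _ ⟨ω, hω, rfl⟩
  have h1 : Tendsto (fun x : ℝ => (x : ℂ) + ω * I) (𝓝[>] 0) (𝓝 (ω * I)) :=
    (Continuous.tendsto' (by fun_prop) _ _ (by simp)).mono_left nhdsWithin_le_nhds
  refine le_of_tendsto ((differentiableAt_value hω).continuousAt.norm.tendsto.comp h1) ?_
  filter_upwards [self_mem_nhdsWithin] with x hx
  exact norm_value_le_of_gain_le hG hp hdeg hK0 hK (by simpa using hx)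

/-! ### Gains of linear systems -/

theorem IsLTI.map_zero (hR : IsLTI R) : R 0 = 0 := by
  have h := hR.linear 1 0 0
  simpa using h

theorem IsLTI.map_sub (hR : IsLTI R) (u v : L2e) : R (u - v) = R u - R v := by
  have h := hR.linear (-1) v u
  have e : ∀ w : L2e, (-1 : ℝ) • w = -w := fun w => neg_one_smul ℝ w
  rw [e, e, neg_add_eq_sub, neg_add_eq_sub] at h
  exact h

theorem l2norm_zero : l2norm 0 = 0 := by
  rw [l2norm, eLpNorm_congr_ae AEEqFun.coeFn_zero, eLpNorm_zero]

theorem l2norm_sub_lt_top {u v : Signal} (hu : l2norm u < ∞) (hv : l2norm v < ∞) :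
    l2norm (u - v) < ∞ := by
  rw [l2norm, eLpNorm_congr_ae (AEEqFun.coeFn_sub u v)]
  exact (MemLp.sub ⟨u.aestronglyMeasurable, hu⟩ ⟨v.aestronglyMeasurable, hv⟩).2

theorem l2norm_ne_zero {u : L2e} (hu : u ≠ 0) : l2norm u ≠ 0 := by
  intro h
  rw [l2norm, eLpNorm_eq_zero_iff (u : Signal).aestronglyMeasurable (by norm_num)] at h
  exact hu (Subtype.ext (AEEqFun.ext (h.trans AEEqFun.coeFn_zero.symm)))

theorem incGain_eq_gain (hR : IsLTI R) : incGain R = gain R := by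
  refine le_antisymm ?_ ?_
  · refine iSup₂_le fun u₁ h₁ => iSup₂_le fun u₂ h₂ => iSup_le fun hne => ?_
    have hmem : u₁ - u₂ ∈ l2dom R := by
      refine ⟨l2norm_sub_lt_top h₁.1 h₂.1, ?_⟩
      rw [hR.map_sub]
      exact l2norm_sub_lt_top h₁.2 h₂.2
    rw [← hR.map_sub]
    exact le_iSup₂_of_le (u₁ - u₂) hmem (le_iSup_of_le (sub_ne_zero.2 hne) le_rfl)
  · refine iSup₂_le fun u hu => iSup_le fun hne => ?_
    have h0 : (0 : L2e) ∈ l2dom R := by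
      constructor
      · exact l2norm_zero.trans_lt ENNReal.zero_lt_top
      · rw [hR.map_zero]
        exact l2norm_zero.trans_lt ENNReal.zero_lt_top
    refine le_iSup₂_of_le u hu (le_iSup₂_of_le 0 h0 (le_iSup_of_le hne ?_))
    rw [hR.map_zero, sub_zero, sub_zero]

theorem gain_le {C : ℝ≥0∞} (h : ∀ u : L2e, l2norm u < ∞ → l2norm (R u) ≤ C * l2norm u) :
    gain R ≤ C :=
  iSup₂_le fun u hu => iSup_le fun _ => ENNReal.div_le_of_le_mul (h u hu.1)

/-- Stability puts every L₂ input in the domain over which the gain is a supremum. -/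
theorem l2norm_le_gain_mul (hR : IsLTI R) (hst : IsL2Stable R) {u : L2e} (hu : l2norm u < ∞) :
    l2norm (R u) ≤ gain R * l2norm u := by
  by_cases h0 : u = 0
  · rw [h0, hR.map_zero]
    exact l2norm_zero.trans_le zero_le
  · have h : l2norm (R u) / l2norm u ≤ gain R :=
      le_iSup₂_of_le u ⟨hu, hst u hu⟩ (le_iSup_of_le h0 le_rfl)
    exact (ENNReal.div_le_iff (l2norm_ne_zero h0) hu.ne).1 h

theorem radius_eq_gain (hR : IsLTI R) (hG : HasTransferFunction R G)
    (hp : ∀ p ∈ poles G, p.re < 0) (hdeg : (numC G).natDegree ≤ (denC G).natDegree)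
    (hst : IsL2Stable R) (hgain : gain R < ∞) : radius (extendedSRG G) = gain R := by
  refine le_antisymm (ENNReal.le_of_forall_pos_le_add fun ε hε _ => ?_) ?_
  -- The slack ε makes the bound strictly positive, as both the radius and the test-signal estimate
  -- require, even when the gain is 0.
  · have hpos : 0 < (gain R).toReal + ε := by positivity
    have hK : ENNReal.ofReal ((gain R).toReal + ε) = gain R + ε := by
      rw [ENNReal.ofReal_add ENNReal.toReal_nonneg ε.coe_nonneg, ENNReal.ofReal_toReal hgain.ne,
        ENNReal.ofReal_coe_nnreal]
    rw [← hK]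
    refine iInf₂_le_of_le _ hpos (iInf_le_of_le (extendedSRG_subset_closedBall hp ?_) le_rfl)
    refine norm_nyquist_le_of_gain_le hG hp hdeg hpos fun u hu => ?_
    refine (l2norm_le_gain_mul hR hst hu).trans ?_
    rw [hK]
    gcongr
    exact le_self_add
  · refine le_iInf₂ fun r _ => le_iInf fun hr => gain_le fun u hu => l2norm_le hG hp ?_ hu
    exact fun z hz => mem_closedBall_zero_iff.1 (hr (nyquist_subset_extendedSRG G hz))

end Gain

end

end ExtSRG

end

theorem mainTheorem5 (R : ExtSRG.L2e → ExtSRG.L2e) (G : RatFunc ℝ)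
    (hLTI : ExtSRG.IsLTI R) (hG : ExtSRG.HasTransferFunction R G)
    (hbdd : Bornology.IsBounded (ExtSRG.extendedSRG G)) :
    (∀ p ∈ ExtSRG.poles G, p.re < 0) ∧
      ExtSRG.IsL2Stable R ∧
      ExtSRG.incGain R < ⊤ ∧
      ExtSRG.gain R < ⊤ ∧
      ExtSRG.radius (ExtSRG.extendedSRG G) = ExtSRG.incGain R ∧
      ExtSRG.incGain R = ExtSRG.gain R := by
  obtain ⟨r, hr⟩ := hbdd.subset_closedBall 0
  have hnyq : ∀ z ∈ ExtSRG.nyquist G, ‖z‖ ≤ r := fun z hz =>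
    mem_closedBall_zero_iff.1 (hr (ExtSRG.nyquist_subset_extendedSRG G hz))
  have hp : ∀ p ∈ ExtSRG.poles G, p.re < 0 := fun p hp => ExtSRG.re_neg_of_mem_poles hr hp
  have hle := fun (u : ExtSRG.L2e) (hu : ExtSRG.l2norm u < ⊤) => ExtSRG.l2norm_le hG hp hnyq hu
  have hst : ExtSRG.IsL2Stable R := fun u hu =>
    (hle u hu).trans_lt (ENNReal.mul_lt_top ENNReal.ofReal_lt_top hu)
  have hgain : ExtSRG.gain R < ⊤ := (ExtSRG.gain_le hle).trans_lt ENNReal.ofReal_lt_top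
  have heq := ExtSRG.incGain_eq_gain hLTI
  refine ⟨hp, hst, heq ▸ hgain, hgain, ?_, heq⟩
  rw [heq]
  exact ExtSRG.radius_eq_gain hLTI hG hp (ExtSRG.natDegree_numC_le hnyq) hst hgain
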